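/- Let $n\ge 1$, let $\phi:\mathbb{R}^n\to\mathbb{R}$ be $L$-Lipschitz and let $\Omega=\{(x,y)\in\mathbb{R}^{n}\times\mathbb{R}: y>\phi(x)\}$. Let $0<\theta<1$, and let $\alpha>0$ satisfy $\alpha<1/L$ (no upper restriction if $L=0$). For $x\in\mathbb{R}^n$ and $0<t<\infty$ put \[ \Gamma_{\alpha,0,t}(x)=\{(z,y)\in\mathbb{R}^n\times\mathbb{R}: |z-x|<\alpha\,(y-\phi(x)),\ \phi(z)<y<\phi(z)+t\}, \] and for $u\in C^2(\Omega)$ define the truncated area function \[ (A_{\alpha,0,t}u)(x)=\left(\int_{\Gamma_{\alpha,0,t}(x)}|\nabla u(z,y)|^2\,(y-\phi(x))^{1-n}\,dz\,dy\right)^{1/2}\in[0,\infty]. \] There is a constant $c>0$, depending only on $\alpha$, $\theta$, $n$ and $L$, such that the following holds. Let $u\in C^2(\Omega)$ be real-valued with \[ |u\,\Delta u|\le\theta\,|\nabla u|^2\quad\text{in }\Omega , \] and bounded, $|u|\le M$ in $\Omega$ for some $M>0$. Then for every dyadic cube $Q=\prod_{i=1}^n[j_i2^{-m},(j_i+1)2^{-m}]\subset\mathbb{R}^n$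 ($m\in\mathbb{Z}$, $j\in\mathbb{Z}^n$), with side length $l(Q)=2^{-m}$, \[ \int_Q\big(A_{\alpha,0,l(Q)}u\big)^2(x)\,dx< c\,M^2\,l(Q)^n . \] In particular, if $|u|\le 1$ in $\Omega$, the integral is less than $c\,l(Q)^n$. -/

import Mathlib

open MeasureTheory
open scoped NNReal ENNReal

noncomputable section

namespace LipschitzGraph

/-- The space `ℝⁿ` with its Euclidean norm. -/
abbrev Base (n : ℕ) : Type := EuclideanSpace ℝ (Fin n)

/-- The space `ℝⁿ⁺¹ = ℝⁿ × ℝ` with its Euclidean norm and Lebesgue measure;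
a point `p = (z, y)` has `z = p.fst` and `y = p.snd`. -/
abbrev Ambient (n : ℕ) : Type := WithLp 2 (Base n × ℝ)

variable {n : ℕ}

/-- The domain `Ω = {(x, y) : y > φ(x)}` above the graph of `φ`. -/
def domain (φ : Base n → ℝ) : Set (Ambient n) :=
  {p | φ p.fst < p.snd}

/-- The cone `Γ_α(x) = {(z, y) : |z - x| < α (y - φ(x))}` with vertex `(x, φ(x))`. -/
def cone (φ : Base n → ℝ) (α : ℝ) (x : Base n) : Set (Ambient n) :=
  {p | ‖p.fst - x‖ < α * (p.snd - φ x)}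

/-- The truncated cone `Γ_{α,s,t}(x) = Γ_α(x) ∩ {(z, y) : φ(z) + s < y < φ(z) + t}`,
for finite truncation heights. -/
def truncatedCone (φ : Base n → ℝ) (α s t : ℝ) (x : Base n) : Set (Ambient n) :=
  cone φ α x ∩ {p | φ p.fst + s < p.snd ∧ p.snd < φ p.fst + t}

/-- The truncated area function of a density `f`, with values in `[0, ∞]`:
`(∫_{Γ_{α,s,t}(x)} f(z, y) (y - φ(x))^{1 - n} dz dy)^{1/2}`. -/
def areaFunction (φ : Base n → ℝ) (α s t : ℝ) (f : Ambient n → ℝ≥0∞) (x : Base n) : ℝ≥0∞ :=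
  (∫⁻ p in truncatedCone φ α s t x,
    f p * ENNReal.ofReal ((p.snd - φ x) ^ (1 - (n : ℤ)))) ^ (1 / 2 : ℝ)

/-- The density `|∇u|²`. -/
def gradSq (u : Ambient n → ℝ) (p : Ambient n) : ℝ≥0∞ :=
  ENNReal.ofReal (‖gradient u p‖ ^ 2)

/-- The condition `|u Δu| ≤ θ |∇u|²` at every point of `Ω`. -/
def SharpCondition (φ : Base n → ℝ) (θ : ℝ) (u : Ambient n → ℝ) : Prop :=
  ∀ p ∈ domain φ, |u p * Laplacian.laplacian u p| ≤ θ * ‖gradient u p‖ ^ 2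

/-- The side length `2^{-m}` of a dyadic cube of generation `m`. -/
def sideLength (m : ℤ) : ℝ := (2 : ℝ) ^ (-m)

/-- The closed dyadic cube `∏ᵢ [jᵢ 2^{-m}, (jᵢ + 1) 2^{-m}]` of `ℝⁿ`. -/
def dyadicCube (m : ℤ) (j : Fin n → ℤ) : Set (Base n) :=
  {x | ∀ i, (j i : ℝ) * sideLength m ≤ x i ∧ x i ≤ ((j i : ℝ) + 1) * sideLength m}

end LipschitzGraph

end

/-!
The function `w = u² / 2` satisfies `Δw = |∇u|² + u Δu ≥ (1 - θ) |∇u|²`, so that integrating `Δw`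
against the distance to the graph should bound `∫ |∇u|² (y - φ) dz dy` over a Carleson box by
boundary integrals of `w ≤ M² / 2`. This is the Carleson estimate `exists_carleson_const`. The
bound for the area function follows from it by Tonelli's theorem (`lintegral_areaFunction_sq_le`),
because the vertices `x` whose cones contain `(z, y)` fill a ball about `z` of radius comparable
to `y - φ(z)`.

For a graph that is only Lipschitz the distance to the graph has to be replaced by a function that
is nearly harmonic near the boundary. Let `ψ` be smooth and `L`-Lipschitz, and let `P(z, t)` be
the average of `ψ` against the Gaussian density of scale `t`, so that `∂ₜP = t ΔP`. With a
bound `B` for `|t ΔP|` that depends only on `n` and `L`, and with `ℓ = 1 + B`, the map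
`(z, t) ↦ (z, P(z, t) + ℓ t)`
flattens the domain above the graph of `ψ`, with Jacobian `J = ℓ + t ΔP ≥ 1`. In these coordinates
`|∇u|²` is integrated against `t J β²`, where `β` is a cutoff (`FlatSolution.energy_density_le`,
`FlatSolution.integral_energy_le`). Each error term contains a derivative of the cutoff, or one of
`t^(1/2) ΔP` and `t^(3/2) ∇ΔP`, as a factor. The squares of these two functions have bounded
integrals over a Carleson box (`CaloricExtension.integral_D_sq_le`,
`CaloricExtension.integral_H_sq_le`), which is the energy identity of the heat equation for `∇P`
and `ΔP`; the remaining factors are bounded by `M²` or are absorbed by the left-hand side through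
`M |∇u| ≤ ε |∇u|² + M² / (4 ε)`. Two error terms, `u ∂_y u` and `u² ΔP`, have no such structure,
and further integrations by parts remove them.

A Lipschitz function `φ` is the limit of smooth functions `ψ > φ` with the same Lipschitz constant
(`exists_smooth_above`). Their graphs lie in the domain of `u`, so the estimate applies to them
without any assumption at the boundary, and Fatou's lemma passes to the limit.
-/

namespace LipschitzGraph

noncomputable section

open Set Metric

variable {n : ℕ}

/-! ### Divergence theorems on a slab -/

/-- The trace of an endomorphism of `ℝⁿ`, computed in the standard basis. -/
def tr (A : Base n →L[ℝ] Base n) : ℝ :=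
  ∑ i, A (EuclideanSpace.single i 1) i

lemma continuous_tr : Continuous (tr (n := n)) := by
  unfold tr
  fun_prop

lemma sum_apply_single_mul (l : Base n →L[ℝ] ℝ) (F : Base n) :
    ∑ i, l (EuclideanSpace.single i 1) * F i = l F := by
  conv_rhs => rw [← (EuclideanSpace.basisFun (Fin n) ℝ).sum_repr F]
  simp [map_sum, mul_comm]

lemma hasGradientAt_mul {E : Type*} [NormedAddCommGroup E] [InnerProductSpace ℝ E]
    [CompleteSpace E] {f g : E → ℝ} {f' g' z : E}
    (hf : HasGradientAt f f' z) (hg : HasGradientAt g g' z) :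
    HasGradientAt (fun z => f z * g z) (f z • g' + g z • f') z := by
  rw [hasGradientAt_iff_hasFDerivAt] at *
  exact (hf.mul hg).congr_fderiv (by ext y; simp)

lemma hasGradientAt_const_mul {E : Type*} [NormedAddCommGroup E] [InnerProductSpace ℝ E]
    [CompleteSpace E] {f : E → ℝ} {f' z : E} (c : ℝ)
    (hf : HasGradientAt f f' z) :
    HasGradientAt (fun z => c * f z) (c • f') z := by
  rw [hasGradientAt_iff_hasFDerivAt] at *
  exact (hf.const_mul c).congr_fderiv (by ext y; simp)

lemma hasGradientAt_const_add {E : Type*} [NormedAddCommGroup E] [InnerProductSpace ℝ E]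
    [CompleteSpace E] {f : E → ℝ} {f' z : E} (c : ℝ)
    (hf : HasGradientAt f f' z) :
    HasGradientAt (fun z => c + f z) f' z := by
  rw [hasGradientAt_iff_hasFDerivAt] at *
  exact hf.const_add c

/-- The divergence theorem for the compactly supported field `f F`. -/
lemma integral_div_smul {f : Base n → ℝ} {f' F : Base n → Base n}
    {F' : Base n → Base n →L[ℝ] Base n} (hfc : Continuous f) (hf'c : Continuous f')
    (hFc : Continuous F) (hF'c : Continuous F') (hs : HasCompactSupport f)
    (hf : ∀ z, HasGradientAt f (f' z) z) (hF : ∀ z, HasFDerivAt F (F' z) z) :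
    ∫ z, (inner ℝ (f' z) (F z) + f z * tr (F' z)) = 0 := by
  have hs' : HasCompactSupport f' := by
    refine hs.mono' (fun z hz => ?_)
    by_contra hzs
    apply hz
    have h0 : f =ᶠ[nhds z] fun _ => (0 : ℝ) := notMem_tsupport_iff_eventuallyEq.1 hzs
    exact (hf z).unique ((hasGradientAt_const z (0 : ℝ)).congr_of_eventuallyEq h0)
  have key : ∀ i : Fin n,
      ∫ z, f z * (F' z (EuclideanSpace.single i 1)) i
        = -∫ z, inner ℝ (f' z) (EuclideanSpace.single i (1 : ℝ)) * F z i := by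
    intro i
    have hFi : ∀ z, HasFDerivAt (fun z => F z i)
        ((EuclideanSpace.proj i : Base n →L[ℝ] ℝ).comp (F' z)) z := fun z =>
      (EuclideanSpace.proj i : Base n →L[ℝ] ℝ).hasFDerivAt.comp z (hF z)
    have := integral_bilinear_hasFDerivAt_right_eq_neg_left_of_integrable (μ := volume)
      (f := f) (f' := fun z => InnerProductSpace.toDual ℝ (Base n) (f' z))
      (g := fun z => F z i) (g' := fun z => (EuclideanSpace.proj i : Base n →L[ℝ] ℝ).comp (F' z))
      (v := EuclideanSpace.single i 1) (B := ContinuousLinearMap.mul ℝ ℝ)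
      ?_ ?_ ?_ (fun z _ => (hf z).hasFDerivAt) (fun z _ => hFi z)
    · simpa using this
    · apply Continuous.integrable_of_hasCompactSupport
      · simp only [InnerProductSpace.toDual_apply_apply, ContinuousLinearMap.mul_apply']
        fun_prop
      · refine hs'.mono (fun z hz => ?_)
        contrapose! hz
        simp only [Function.mem_support, not_not] at hz ⊢
        simp [hz]
    · apply Continuous.integrable_of_hasCompactSupport
      · simp only [ContinuousLinearMap.mul_apply']
        fun_prop
      · exact hs.mul_right
    · apply Continuous.integrable_of_hasCompactSupport
      · simp only [ContinuousLinearMap.mul_apply']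
        fun_prop
      · exact hs.mul_right
  have hi1 : ∀ i : Fin n, Integrable (fun z => f z * (F' z (EuclideanSpace.single i 1)) i) := by
    intro i
    apply Continuous.integrable_of_hasCompactSupport
    · fun_prop
    · exact hs.mul_right
  have hi2 : ∀ i : Fin n,
      Integrable (fun z => inner ℝ (f' z) (EuclideanSpace.single i (1 : ℝ)) * F z i) := by
    intro i
    apply Continuous.integrable_of_hasCompactSupport
    · fun_prop
    · refine hs'.mono (fun z hz => ?_)
      contrapose! hz
      simp only [Function.mem_support, not_not] at hz ⊢
      simp [hz]
  have e : ∀ z, inner ℝ (f' z) (F z) + f z * tr (F' z)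
      = ∑ i, (inner ℝ (f' z) (EuclideanSpace.single i (1 : ℝ)) * F z i
          + f z * (F' z (EuclideanSpace.single i 1)) i) := by
    intro z
    rw [Finset.sum_add_distrib, tr, Finset.mul_sum]
    congr 1
    exact (sum_apply_single_mul (innerSL ℝ (f' z)) (F z)).symm
  simp_rw [e]
  rw [integral_finsetSum (μ := volume) (f := fun i z =>
    inner ℝ (f' z) (EuclideanSpace.single i (1 : ℝ)) * F z i
      + f z * (F' z (EuclideanSpace.single i 1)) i) _ (fun i _ => (hi2 i).add (hi1 i))]
  apply Finset.sum_eq_zero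
  intro i _
  rw [integral_add (hi2 i) (hi1 i), key i]
  ring

/-- Lebesgue measure on the slab `B̄(z₀, R) × [0, T]`. -/
def slab (z₀ : Base n) (R T : ℝ) : Measure (Base n × ℝ) :=
  (volume.restrict (closedBall z₀ R)).prod (volume.restrict (Icc 0 T))

instance (z₀ : Base n) (R : ℝ) : IsFiniteMeasure (volume.restrict (closedBall z₀ R)) :=
  ⟨by simpa using measure_closedBall_lt_top⟩

instance (z₀ : Base n) (R T : ℝ) : IsFiniteMeasure (slab z₀ R T) := by
  unfold slab; infer_instance

lemma integrable_slab {E : Type*} [NormedAddCommGroup E]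
    {f : Base n × ℝ → E} (hf : Continuous f) (z₀ : Base n) (R T : ℝ) :
    Integrable f (slab z₀ R T) := by
  rw [slab, Measure.prod_restrict]
  exact hf.continuousOn.integrableOn_compact ((isCompact_closedBall z₀ R).prod isCompact_Icc)

lemma ae_slab (z₀ : Base n) (R T : ℝ) :
    ∀ᵐ p ∂slab z₀ R T, p.1 ∈ closedBall z₀ R ∧ p.2 ∈ Icc 0 T := by
  rw [slab, Measure.prod_restrict]
  exact ae_restrict_mem (measurableSet_closedBall.prod measurableSet_Icc)

/-- The spatial divergence of a field that vanishes outside the ball has no integral. As in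
`integral_slab_deriv`, the derivatives are needed only at interior times. -/
lemma integral_slab_div {z₀ : Base n} {R T : ℝ} {f : Base n → ℝ → ℝ} {f' F : Base n → ℝ → Base n}
    {F' : Base n → ℝ → Base n →L[ℝ] Base n}
    (hfc : Continuous fun p : Base n × ℝ => f p.1 p.2)
    (hf'c : Continuous fun p : Base n × ℝ => f' p.1 p.2)
    (hFc : Continuous fun p : Base n × ℝ => F p.1 p.2)
    (hF'c : Continuous fun p : Base n × ℝ => F' p.1 p.2)
    (hs : ∀ z ∉ closedBall z₀ R, ∀ t, f z t = 0)
    (hf : ∀ z, ∀ t ∈ Ioo 0 T, HasGradientAt (f · t) (f' z t) z)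
    (hF : ∀ z, ∀ t ∈ Ioo 0 T, HasFDerivAt (F · t) (F' z t) z) :
    ∫ p, (inner ℝ (f' p.1 p.2) (F p.1 p.2) + f p.1 p.2 * tr (F' p.1 p.2)) ∂slab z₀ R T = 0 := by
  have hc : Continuous fun p : Base n × ℝ =>
      inner ℝ (f' p.1 p.2) (F p.1 p.2) + f p.1 p.2 * tr (F' p.1 p.2) :=
    (hf'c.inner hFc).add (hfc.mul (continuous_tr.comp hF'c))
  rw [slab, integral_prod_symm _ (integrable_slab hc z₀ R T),
    integral_Icc_eq_integral_Ioo]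
  refine (setIntegral_congr_fun measurableSet_Ioo (g := fun _ => (0 : ℝ)) fun t ht => ?_).trans
    (by simp)
  have hsz : HasCompactSupport (f · t) :=
    HasCompactSupport.intro (isCompact_closedBall z₀ R) (fun z hz => hs z hz t)
  have slice : ∀ {Y : Type} [TopologicalSpace Y] {g : Base n → ℝ → Y},
      Continuous (fun p : Base n × ℝ => g p.1 p.2) → Continuous (g · t) :=
    fun hg => hg.comp (Continuous.prodMk_left t)
  have h0 : ∀ z ∉ closedBall z₀ R, f' z t = 0 := by
    intro z hz
    have h0 : (f · t) =ᶠ[nhds z] fun _ => (0 : ℝ) := by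
      filter_upwards [isClosed_closedBall.isOpen_compl.mem_nhds hz] with y hy using hs y hy t
    exact (hf z t ht).unique ((hasGradientAt_const z (0 : ℝ)).congr_of_eventuallyEq h0)
  dsimp only
  rw [setIntegral_eq_integral_of_forall_compl_eq_zero]
  · exact integral_div_smul (slice hfc) (slice hf'c) (slice hFc) (slice hF'c) hsz
      (fun z => hf z t ht) (fun z => hF z t ht)
  · intro z hz
    simp [hs z hz, h0 z hz]

/-- The fundamental theorem of calculus in the time variable. -/
lemma integral_slab_deriv {z₀ : Base n} {R T : ℝ} (hT : 0 ≤ T) {f f' : Base n → ℝ → ℝ}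
    (hfc : Continuous fun p : Base n × ℝ => f p.1 p.2)
    (hf'c : Continuous fun p : Base n × ℝ => f' p.1 p.2)
    (hf : ∀ z, ∀ t ∈ Ioo 0 T, HasDerivAt (f z) (f' z t) t) :
    ∫ p, f' p.1 p.2 ∂slab z₀ R T = ∫ z in closedBall z₀ R, (f z T - f z 0) := by
  rw [slab, integral_prod _ (integrable_slab hf'c z₀ R T)]
  refine integral_congr_ae (Filter.Eventually.of_forall fun z => ?_)
  have h1 : Continuous (f z) := hfc.comp (Continuous.prodMk_right z)
  have h2 : Continuous (f' z) := hf'c.comp (Continuous.prodMk_right z)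
  dsimp only
  rw [integral_Icc_eq_integral_Ioc, ← intervalIntegral.integral_of_le hT]
  exact intervalIntegral.integral_eq_sub_of_hasDerivAt_of_le hT h1.continuousOn
    (hf z) (h2.intervalIntegrable _ _)

end

end LipschitzGraph

namespace LipschitzGraph

noncomputable section

open Set Metric

variable {n : ℕ}

/-! ### The Carleson estimate for the caloric extension -/

/-- The data of a function `P(z, t)` on `ℝⁿ × ℝ` with `∂ₜP = t ΔP`, that is, of a solution of the
heat equation in the time variable `t² / 2`, together with its derivatives:
`G = ∇P`, `D = ΔP`, `H = ∇ΔP`, `K = Δ²P`, where `G'` and `H'` are the spatial derivatives of `G`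
and `H`. The bounds are `|∇P| ≤ L` and `|∂ₜP| ≤ B`. -/
structure CaloricExtension (n : ℕ) (L B : ℝ) where
  P : Base n → ℝ → ℝ
  G : Base n → ℝ → Base n
  D : Base n → ℝ → ℝ
  H : Base n → ℝ → Base n
  K : Base n → ℝ → ℝ
  G' : Base n → ℝ → Base n →L[ℝ] Base n
  H' : Base n → ℝ → Base n →L[ℝ] Base n
  continuous_P : Continuous fun p : Base n × ℝ => P p.1 p.2
  continuous_G : Continuous fun p : Base n × ℝ => G p.1 p.2
  continuous_D : Continuous fun p : Base n × ℝ => D p.1 p.2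
  continuous_H : Continuous fun p : Base n × ℝ => H p.1 p.2
  continuous_G' : Continuous fun p : Base n × ℝ => G' p.1 p.2
  continuous_H' : Continuous fun p : Base n × ℝ => H' p.1 p.2
  grad_P : ∀ z t, HasGradientAt (P · t) (G z t) z
  grad_D : ∀ z t, HasGradientAt (D · t) (H z t) z
  fderiv_G : ∀ z t, HasFDerivAt (G · t) (G' z t) z
  fderiv_H : ∀ z t, HasFDerivAt (H · t) (H' z t) z
  tr_G' : ∀ z t, tr (G' z t) = D z t
  tr_H' : ∀ z t, tr (H' z t) = K z t
  deriv_P : ∀ z t, HasDerivAt (P z) (t * D z t) t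
  deriv_G : ∀ z t, HasDerivAt (G z) (t • H z t) t
  deriv_D : ∀ z t, HasDerivAt (D z) (t * K z t) t
  norm_G : ∀ z t, ‖G z t‖ ≤ L
  abs_D : ∀ z t, |t * D z t| ≤ B

attribute [fun_prop] CaloricExtension.continuous_P CaloricExtension.continuous_G
  CaloricExtension.continuous_D CaloricExtension.continuous_H CaloricExtension.continuous_G'
  CaloricExtension.continuous_H'

lemma CaloricExtension.continuous_K {L B : ℝ} (F : CaloricExtension n L B) :
    Continuous fun p : Base n × ℝ => F.K p.1 p.2 := by
  simp_rw [← F.tr_H']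
  exact continuous_tr.comp F.continuous_H'

attribute [fun_prop] CaloricExtension.continuous_K

/-- A continuously differentiable spatial cutoff function, with values in `[0, 1]`, that vanishes
outside the ball `B̄(z₀, R)` and whose gradient `b'` is bounded by `κ`. -/
structure Cutoff (z₀ : Base n) (R κ : ℝ) where
  b : Base n → ℝ
  b' : Base n → Base n
  continuous_b : Continuous b
  continuous_b' : Continuous b'
  grad_b : ∀ z, HasGradientAt b (b' z) z
  nonneg : ∀ z, 0 ≤ b z
  le_one : ∀ z, b z ≤ 1
  eq_zero : ∀ z ∉ closedBall z₀ R, b z = 0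
  norm_b' : ∀ z, ‖b' z‖ ≤ κ

attribute [fun_prop] Cutoff.continuous_b Cutoff.continuous_b'

section

variable {z₀ : Base n} {R κ L B T : ℝ}

/-- The square of the space-time cutoff `b(z) (1 - t / T)`. -/
def Cutoff.sq (η : Cutoff z₀ R κ) (T : ℝ) (z : Base n) (t : ℝ) : ℝ :=
  η.b z ^ 2 * (1 - t / T) ^ 2

lemma Cutoff.grad_sq (η : Cutoff z₀ R κ) (T : ℝ) (z : Base n) (t : ℝ) :
    HasGradientAt (η.sq T · t) ((2 * η.b z * (1 - t / T) ^ 2) • η.b' z) z := by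
  have h := hasGradientAt_const_mul ((1 - t / T) ^ 2) (hasGradientAt_mul (η.grad_b z) (η.grad_b z))
  convert h using 1
  · funext y
    simp only [Cutoff.sq]
    ring
  · module

lemma Cutoff.deriv_sq (η : Cutoff z₀ R κ) (T : ℝ) (z : Base n) (t : ℝ) :
    HasDerivAt (η.sq T z) (-(2 / T * η.b z ^ 2 * (1 - t / T))) t := by
  have h := ((((hasDerivAt_id t).div_const T).const_sub 1).pow 2).const_mul (η.b z ^ 2)
  exact h.congr_deriv (by simp; ring)

lemma Cutoff.continuous_sq (η : Cutoff z₀ R κ) (T : ℝ) :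
    Continuous fun p : Base n × ℝ => η.sq T p.1 p.2 := by
  unfold Cutoff.sq
  fun_prop

attribute [fun_prop] Cutoff.continuous_sq

lemma Cutoff.sq_eq_zero (η : Cutoff z₀ R κ) (T : ℝ) {z : Base n} (hz : z ∉ closedBall z₀ R)
    (t : ℝ) : η.sq T z t = 0 := by
  simp [Cutoff.sq, η.eq_zero z hz]

lemma Cutoff.sq_end (η : Cutoff z₀ R κ) (hT : 0 < T) (z : Base n) : η.sq T z T = 0 := by
  simp [Cutoff.sq, hT.ne']

lemma Cutoff.sq_zero (η : Cutoff z₀ R κ) (z : Base n) : η.sq T z 0 = η.b z ^ 2 := by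
  simp [Cutoff.sq]

lemma integral_slab_const (hT : 0 ≤ T) (c : ℝ) :
    ∫ _, c ∂slab z₀ R T = c * (T * volume.real (closedBall z₀ R)) := by
  rw [integral_const, slab]
  have : (univ : Set (Base n × ℝ)) = univ ×ˢ univ := by simp
  rw [this, measureReal_prod_prod]
  simp [hT, smul_eq_mul]
  ring

/-- The local Carleson estimate `∫∫ t |ΔP|² ≲ |B̄(z₀, R)|`. Since `∂ₜ∇P = t ∇ΔP`, twice the
divergence of `t ΔP ∇P` minus the time derivative of `|∇P|²` is `2 t |ΔP|²`. -/
lemma CaloricExtension.integral_D_sq_le (F : CaloricExtension n L B) (η : Cutoff z₀ R κ)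
    (hT : 0 < T) :
    ∫ p, p.2 * η.sq T p.1 p.2 * F.D p.1 p.2 ^ 2 ∂slab z₀ R T
      ≤ (1 + 4 * (κ * T) ^ 2) * L ^ 2 * volume.real (closedBall z₀ R) := by
  set V := volume.real (closedBall z₀ R)
  have hdiv := integral_slab_div (z₀ := z₀) (R := R) (T := T)
    (f := fun z t => η.sq T z t * (t * F.D z t))
    (f' := fun z t => η.sq T z t • (t • F.H z t)
      + (t * F.D z t) • ((2 * η.b z * (1 - t / T) ^ 2) • η.b' z))
    (F := F.G) (F' := F.G') (by fun_prop) (by fun_prop) (by fun_prop) (by fun_prop)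
    (fun z hz t => by simp [η.sq_eq_zero T hz])
    (fun z t _ => hasGradientAt_mul (η.grad_sq T z t) (hasGradientAt_const_mul t (F.grad_D z t)))
    (fun z t _ => F.fderiv_G z t)
  have hder := integral_slab_deriv (z₀ := z₀) (R := R) hT.le
    (f := fun z t => η.sq T z t * ‖F.G z t‖ ^ 2)
    (f' := fun z t => -(2 / T * η.b z ^ 2 * (1 - t / T)) * ‖F.G z t‖ ^ 2
      + η.sq T z t * (2 * inner ℝ (F.G z t) (t • F.H z t)))
    (by fun_prop) (by fun_prop)
    (fun z t _ => (η.deriv_sq T z t).mul (F.deriv_G z t).norm_sq)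
  have hbd : -L ^ 2 * V
      ≤ ∫ z in closedBall z₀ R, (η.sq T z T * ‖F.G z T‖ ^ 2 - η.sq T z 0 * ‖F.G z 0‖ ^ 2) := by
    have : ∫ z in closedBall z₀ R, (-L ^ 2 : ℝ) = -L ^ 2 * V := by
      simp [V, mul_comm]
    rw [← this]
    refine integral_mono (integrable_const _) ?_ fun z => ?_
    · refine ContinuousOn.integrableOn_compact (isCompact_closedBall z₀ R) ?_
      have := F.continuous_G
      fun_prop
    · simp only [η.sq_end hT, η.sq_zero]
      have h1 : η.b z ^ 2 ≤ 1 := pow_le_one₀ (η.nonneg z) (η.le_one z)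
      have h2 : ‖F.G z 0‖ ^ 2 ≤ L ^ 2 := pow_le_pow_left₀ (norm_nonneg _) (F.norm_G z 0) 2
      nlinarith [sq_nonneg ‖F.G z 0‖]
  rw [← hder] at hbd
  have hmono : ∫ p, p.2 * η.sq T p.1 p.2 * F.D p.1 p.2 ^ 2 ∂slab z₀ R T
      ≤ ∫ p, (2 * (inner ℝ (η.sq T p.1 p.2 • (p.2 • F.H p.1 p.2)
            + (p.2 * F.D p.1 p.2) • ((2 * η.b p.1 * (1 - p.2 / T) ^ 2) • η.b' p.1)) (F.G p.1 p.2)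
          + η.sq T p.1 p.2 * (p.2 * F.D p.1 p.2) * tr (F.G' p.1 p.2))
        - (-(2 / T * η.b p.1 ^ 2 * (1 - p.2 / T)) * ‖F.G p.1 p.2‖ ^ 2
            + η.sq T p.1 p.2 * (2 * inner ℝ (F.G p.1 p.2) (p.2 • F.H p.1 p.2)))
        + 4 * T * κ ^ 2 * L ^ 2) ∂slab z₀ R T := by
    refine integral_mono_ae (integrable_slab (by fun_prop) _ _ _)
      (integrable_slab ?_ _ _ _) ?_
    · have := continuous_tr.comp F.continuous_G'
      simp only [Function.comp_def] at this
      fun_prop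
    · filter_upwards [ae_slab z₀ R T] with p hp
      obtain ⟨z, t⟩ := p
      obtain ⟨-, ht0, htT⟩ := hp
      dsimp only at ht0 htT ⊢
      rw [F.tr_G', inner_add_left]
      simp only [inner_smul_left, inner_smul_right, Cutoff.sq, conj_trivial,
        real_inner_comm (F.G z t) (F.H z t)]
      have hx : |inner ℝ (η.b' z) (F.G z t)| ≤ κ * L :=
        (abs_real_inner_le_norm _ _).trans (mul_le_mul (η.norm_b' z) (F.norm_G z t)
          (norm_nonneg _) ((norm_nonneg _).trans (η.norm_b' z)))
      have hx2 : inner ℝ (η.b' z) (F.G z t) ^ 2 ≤ κ ^ 2 * L ^ 2 := by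
        rw [← mul_pow, ← sq_abs]
        exact pow_le_pow_left₀ (abs_nonneg _) hx 2
      have hχ0 : 0 ≤ 1 - t / T := by
        rw [sub_nonneg, div_le_one hT]; exact htT
      have hχ1 : 1 - t / T ≤ 1 := by
        have : 0 ≤ t / T := by positivity
        linarith
      generalize 1 - t / T = χ at *
      generalize inner ℝ (η.b' z) (F.G z t) = x at *
      generalize F.D z t = d at *
      generalize η.b z = b at *
      have h1 : 0 ≤ 2 / T * b ^ 2 * χ * ‖F.G z t‖ ^ 2 := by positivity
      have h2 : t * χ ^ 2 * x ^ 2 ≤ T * (κ ^ 2 * L ^ 2) := by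
        have : t * χ ^ 2 ≤ T := by nlinarith [pow_le_one₀ (n := 2) hχ0 hχ1]
        exact mul_le_mul this hx2 (sq_nonneg _) hT.le
      -- This square absorbs the term in which the divergence falls on the cutoff.
      have h3 : 0 ≤ t * (b * χ * d + 2 * χ * x) ^ 2 := by positivity
      nlinarith
  refine hmono.trans ?_
  have c1 : Continuous fun p : Base n × ℝ => tr (F.G' p.1 p.2) := continuous_tr.comp F.continuous_G'
  rw [integral_add (integrable_slab (by fun_prop) _ _ _) (integrable_const _),
    integral_sub (integrable_slab (by fun_prop) _ _ _) (integrable_slab (by fun_prop) _ _ _),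
    integral_const_mul, hdiv, integral_slab_const hT.le]
  simp only [V] at *
  linarith

/-- The companion of `integral_D_sq_le` for the next derivative, `∫∫ t³ |∇ΔP|² ≲ |B̄(z₀, R)|`, from
the divergence of `t³ ΔP ∇ΔP` and the time derivative of `(t ΔP)²`. -/
lemma CaloricExtension.integral_H_sq_le (F : CaloricExtension n L B) (η : Cutoff z₀ R κ)
    (hT : 0 < T) :
    ∫ p, p.2 ^ 3 * η.sq T p.1 p.2 * ‖F.H p.1 p.2‖ ^ 2 ∂slab z₀ R T
      ≤ (2 * (1 + 4 * (κ * T) ^ 2) * L ^ 2 + 4 * (κ * T) ^ 2 * B ^ 2)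
        * volume.real (closedBall z₀ R) := by
  set V := volume.real (closedBall z₀ R)
  have hdiv := integral_slab_div (z₀ := z₀) (R := R) (T := T)
    (f := fun z t => η.sq T z t * (t ^ 3 * F.D z t))
    (f' := fun z t => η.sq T z t • (t ^ 3 • F.H z t)
      + (t ^ 3 * F.D z t) • ((2 * η.b z * (1 - t / T) ^ 2) • η.b' z))
    (F := F.H) (F' := F.H') (by fun_prop) (by fun_prop) (by fun_prop) (by fun_prop)
    (fun z hz t => by simp [η.sq_eq_zero T hz])
    (fun z t _ => hasGradientAt_mul (η.grad_sq T z t)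
      (hasGradientAt_const_mul (t ^ 3) (F.grad_D z t)))
    (fun z t _ => F.fderiv_H z t)
  have hder := integral_slab_deriv (z₀ := z₀) (R := R) hT.le
    (f := fun z t => η.sq T z t * (t * F.D z t) ^ 2)
    (f' := fun z t => -(2 / T * η.b z ^ 2 * (1 - t / T)) * (t * F.D z t) ^ 2
      + η.sq T z t * (2 * (t * F.D z t) * (F.D z t + t * (t * F.K z t))))
    (by fun_prop) (by fun_prop)
    (fun z t _ => by
      have h := (η.deriv_sq T z t).mul (((hasDerivAt_id t).mul (F.deriv_D z t)).pow 2)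
      exact h.congr_deriv (by simp))
  have hbd : ∫ z in closedBall z₀ R,
      (η.sq T z T * (T * F.D z T) ^ 2 - η.sq T z 0 * (0 * F.D z 0) ^ 2) = 0 := by
    simp [η.sq_end hT]
  rw [← hder] at hbd
  have c1 : Continuous fun p : Base n × ℝ => tr (F.H' p.1 p.2) := continuous_tr.comp F.continuous_H'
  have hmono : ∫ p, p.2 ^ 3 * η.sq T p.1 p.2 * ‖F.H p.1 p.2‖ ^ 2 ∂slab z₀ R T
      ≤ ∫ p, (2 * (inner ℝ (η.sq T p.1 p.2 • (p.2 ^ 3 • F.H p.1 p.2)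
            + (p.2 ^ 3 * F.D p.1 p.2) • ((2 * η.b p.1 * (1 - p.2 / T) ^ 2) • η.b' p.1))
              (F.H p.1 p.2)
          + η.sq T p.1 p.2 * (p.2 ^ 3 * F.D p.1 p.2) * tr (F.H' p.1 p.2))
        - (-(2 / T * η.b p.1 ^ 2 * (1 - p.2 / T)) * (p.2 * F.D p.1 p.2) ^ 2
            + η.sq T p.1 p.2 * (2 * (p.2 * F.D p.1 p.2)
              * (F.D p.1 p.2 + p.2 * (p.2 * F.K p.1 p.2))))
        + 2 * (p.2 * η.sq T p.1 p.2 * F.D p.1 p.2 ^ 2)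
        + 4 * T * κ ^ 2 * B ^ 2) ∂slab z₀ R T := by
    refine integral_mono_ae (integrable_slab (by fun_prop) _ _ _)
      (integrable_slab (by fun_prop) _ _ _) ?_
    filter_upwards [ae_slab z₀ R T] with p hp
    obtain ⟨z, t⟩ := p
    obtain ⟨-, ht0, htT⟩ := hp
    dsimp only at ht0 htT ⊢
    rw [F.tr_H', inner_add_left]
    simp only [inner_smul_left, Cutoff.sq, conj_trivial, real_inner_self_eq_norm_sq]
    have hx : |inner ℝ (η.b' z) (F.H z t)| ≤ κ * ‖F.H z t‖ :=
      (abs_real_inner_le_norm _ _).trans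
        (mul_le_mul_of_nonneg_right (η.norm_b' z) (norm_nonneg _))
    have hd : (t * F.D z t) ^ 2 ≤ B ^ 2 := by
      rw [← sq_abs]
      exact pow_le_pow_left₀ (abs_nonneg _) (F.abs_D z t) 2
    have hχ0 : 0 ≤ 1 - t / T := by
      rw [sub_nonneg, div_le_one hT]; exact htT
    have hχ1 : 1 - t / T ≤ 1 := by
      have : 0 ≤ t / T := by positivity
      linarith
    have hb0 := η.nonneg z
    generalize 1 - t / T = χ at *
    generalize inner ℝ (η.b' z) (F.H z t) = x at *
    generalize F.D z t = d at *
    generalize F.K z t = k at *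
    generalize η.b z = b at *
    have h1 : 0 ≤ 2 / T * b ^ 2 * χ * (t * d) ^ 2 := by positivity
    have h2 : (t * χ ^ 2) * κ ^ 2 * (t * d) ^ 2 ≤ T * κ ^ 2 * B ^ 2 := by
      have : t * χ ^ 2 ≤ T := by nlinarith [pow_le_one₀ (n := 2) hχ0 hχ1]
      gcongr
    -- The term in which the divergence falls on the cutoff, by Young's inequality.
    have h3 : -(4 * t ^ 3 * d * b * χ ^ 2 * x)
        ≤ t ^ 3 * (b * χ) ^ 2 * ‖F.H z t‖ ^ 2 + 4 * (t * χ ^ 2 * κ ^ 2 * (t * d) ^ 2) := by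
      have h4 : |4 * t ^ 3 * d * b * χ ^ 2 * x|
          ≤ 4 * t ^ 3 * |d| * b * χ ^ 2 * (κ * ‖F.H z t‖) := by
        rw [abs_mul]
        have e : |4 * t ^ 3 * d * b * χ ^ 2| = 4 * t ^ 3 * |d| * b * χ ^ 2 := by
          simp only [abs_mul, abs_pow, abs_of_nonneg ht0, abs_of_nonneg hχ0, abs_of_nonneg hb0]
          norm_num
        rw [e]
        gcongr
      have h5 : 0 ≤ t ^ 3 * (b * χ * ‖F.H z t‖ - 2 * χ * κ * |d|) ^ 2 := by positivity
      have h6 := neg_le_of_abs_le h4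
      have h7 : t ^ 3 * (b * χ * ‖F.H z t‖ - 2 * χ * κ * |d|) ^ 2
          = t ^ 3 * (b * χ) ^ 2 * ‖F.H z t‖ ^ 2 - 4 * t ^ 3 * |d| * b * χ ^ 2 * (κ * ‖F.H z t‖)
            + 4 * (t * χ ^ 2 * κ ^ 2 * (t * d) ^ 2) := by
        rw [mul_pow t d, ← sq_abs d]
        ring
      linarith
    nlinarith
  refine hmono.trans ?_
  rw [integral_add (integrable_slab (by fun_prop) _ _ _) (integrable_const _),
    integral_add (integrable_slab (by fun_prop) _ _ _) (integrable_slab (by fun_prop) _ _ _),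
    integral_sub (integrable_slab (by fun_prop) _ _ _) (integrable_slab (by fun_prop) _ _ _),
    integral_const_mul, hdiv, hbd, integral_const_mul, integral_slab_const hT.le]
  have := F.integral_D_sq_le η hT
  simp only [V] at *
  linarith

end

end

end LipschitzGraph

namespace LipschitzGraph

noncomputable section

open Set Metric

variable {n : ℕ}

/-! ### The energy estimate in flattened coordinates -/

lemma abs_mul_mul_le {c x y X Y : ℝ} (hc : 0 ≤ c) (hx : |x| ≤ X) (hy : |y| ≤ Y) :
    |c * x * y| ≤ c * X * Y := by
  rw [abs_mul, abs_mul, abs_of_nonneg hc]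
  have : 0 ≤ X := (abs_nonneg _).trans hx
  gcongr

lemma add_add_sq_le (k δ y : ℝ) : (k + δ + y) ^ 2 ≤ 3 * (k ^ 2 + δ ^ 2 + y ^ 2) := by
  nlinarith [sq_nonneg (k - δ), sq_nonneg (k - y), sq_nonneg (δ - y)]

lemma mul_add_sq_add_mul_le (k δ y : ℝ) :
    δ * k + δ ^ 2 + y * k ≤ 3 / 2 * (k ^ 2 + δ ^ 2 + y ^ 2) := by
  nlinarith [sq_nonneg (δ - k), sq_nonneg (y - k), sq_nonneg y]

/-- Young's inequality for the error terms of the energy identity: `s` is the size of the gradient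
of the solution, which is absorbed on the left with a small factor `ε`, while `δ` and `y` are the
sizes of the quantities controlled by the Carleson estimates for the caloric extension, and `κ` and `τ`
those of the derivatives of the cutoff. -/
lemma weighted_young_le {t κ τ L B ℓ M s δ y ε : ℝ} (ht : 0 ≤ t) (hκ : 0 ≤ κ) (hτ : 0 ≤ τ)
    (hL : 0 ≤ L) (hℓ : 1 ≤ ℓ) (hB : 0 ≤ B) (hM : 0 ≤ M) (hs0 : 0 ≤ s) (hd0 : 0 ≤ δ) (hh0 : 0 ≤ y)
    (hε : 0 < ε) :
    t * s * M * (2 * (ℓ + B) * κ + 2 * (1 + L) * τ + (1 + L) ^ 2 * δ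
        + 2 * (1 + L) ^ 2 * δ + (ℓ + B) * δ + (1 + L) * y)
      + t * M ^ 2 * (2 * (1 + L) * δ * κ + δ ^ 2 + y * κ)
      + ((1 + L) * M ^ 2 * κ + B * M ^ 2 * τ)
    ≤ ε * (t * s ^ 2)
      + (3 * (3 * (1 + L) ^ 2 + 2 * (ℓ + B)) ^ 2 / (4 * ε)
          + 3 / 2 * (3 * (1 + L) ^ 2 + 2 * (ℓ + B))) * M ^ 2
        * (t * (κ + τ) ^ 2 + t * δ ^ 2 + t * y ^ 2)
      + (1 + L + B) * M ^ 2 * (κ + τ) := by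
  have hA : 1 ≤ 1 + L := by linarith
  have hA2 : 1 + L ≤ (1 + L) ^ 2 := by nlinarith
  have hΛ : 0 ≤ ℓ + B := by linarith
  -- All coefficients are dominated by the one constant `C`, and `κ`, `τ` by `k`.
  set k := κ + τ with hk
  have hk1 : κ ≤ k := by linarith
  have hk2 : τ ≤ k := by linarith
  have hk0 : 0 ≤ k := hκ.trans hk1
  set C := 3 * (1 + L) ^ 2 + 2 * (ℓ + B) with hC
  have hC0 : 0 < C := by positivity
  have hC1 : 2 * (ℓ + B) ≤ C := by linarith
  have hC2 : 2 * (1 + L) ≤ C := by linarith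
  have hC3 : 1 ≤ C := by linarith
  have g1 : t * s * M * (2 * (ℓ + B) * κ + 2 * (1 + L) * (τ) + (1 + L) ^ 2 * δ
      + 2 * (1 + L) ^ 2 * δ + (ℓ + B) * δ + (1 + L) * y) ≤ t * s * M * (C * (k + δ + y)) := by
    have a1 : 2 * (ℓ + B) * κ + 2 * (1 + L) * (τ) ≤ C * k := by
      have : 2 * (ℓ + B) * κ ≤ C * κ := by gcongr
      have : 2 * (1 + L) * (τ) ≤ C * (τ) := by gcongr
      rw [hk, mul_add]; linarith
    have a2 : ((1 + L) ^ 2 + 2 * (1 + L) ^ 2 + (ℓ + B)) * δ ≤ C * δ := by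
      gcongr; linarith
    have a3 : (1 + L) * y ≤ C * y := by gcongr; linarith
    gcongr
    linarith
  have g2' : t * M ^ 2 * (2 * (1 + L) * δ * κ + δ ^ 2 + y * κ)
      ≤ t * M ^ 2 * (C * (3 / 2 * (k ^ 2 + δ ^ 2 + y ^ 2))) := by
    have a1 : 2 * (1 + L) * δ * κ ≤ C * (δ * k) := by
      calc _ = 2 * (1 + L) * (δ * κ) := by ring
        _ ≤ C * (δ * k) := by gcongr
    have a2 : δ ^ 2 ≤ C * δ ^ 2 := le_mul_of_one_le_left (sq_nonneg _) hC3
    have a3 : y * κ ≤ C * (y * k) :=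
      (mul_le_mul_of_nonneg_left hk1 hh0).trans
        (le_mul_of_one_le_left (by positivity) hC3)
    have a4 : C * (δ * k + δ ^ 2 + y * k) ≤ C * (3 / 2 * (k ^ 2 + δ ^ 2 + y ^ 2)) := by
      gcongr
      exact mul_add_sq_add_mul_le k δ y
    gcongr
    linarith
  have g3 : t * s * M * (C * (k + δ + y))
      ≤ ε * (t * s ^ 2) + 3 * C ^ 2 / (4 * ε) * M ^ 2 * (t * (k ^ 2 + δ ^ 2 + y ^ 2)) := by
    have a1 : s * (M * C * (k + δ + y))
        ≤ ε * s ^ 2 + (M * C * (k + δ + y)) ^ 2 / (4 * ε) := by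
      have : ε * s ^ 2 + (M * C * (k + δ + y)) ^ 2 / (4 * ε) - s * (M * C * (k + δ + y))
          = (2 * ε * s - M * C * (k + δ + y)) ^ 2 / (4 * ε) := by
        field_simp
        ring
      have : 0 ≤ (2 * ε * s - M * C * (k + δ + y)) ^ 2 / (4 * ε) := by positivity
      linarith
    have a2 : (M * C * (k + δ + y)) ^ 2 / (4 * ε)
        ≤ (M * C) ^ 2 * (3 * (k ^ 2 + δ ^ 2 + y ^ 2)) / (4 * ε) := by
      rw [mul_pow]
      gcongr
      exact add_add_sq_le k δ y
    calc _ = t * (s * (M * C * (k + δ + y))) := by ring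
      _ ≤ t * (ε * s ^ 2 + (M * C) ^ 2 * (3 * (k ^ 2 + δ ^ 2 + y ^ 2)) / (4 * ε)) := by
        gcongr; linarith
      _ = _ := by ring
  have g4 : (1 + L) * M ^ 2 * κ + B * M ^ 2 * (τ) ≤ (1 + L + B) * M ^ 2 * k := by
    have a1 : (1 + L) * M ^ 2 * κ ≤ (1 + L) * M ^ 2 * k := by gcongr
    have a2 : B * M ^ 2 * (τ) ≤ B * M ^ 2 * k := by gcongr
    linarith
  linarith

set_option maxHeartbeats 1000000 in
/-- A bound for the error terms of the energy identity at one point. With the notation of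
`FlatSolution.energy_density_le`, the cutoff is `b χ`, and `d`, `h` and `σ` are the values of `ΔP`,
`|∇ΔP|` and `|∇u|`, and `g2` is `|∇P|²`. The variables `gU`, `GU`, `gG`, `vG`, `gH` and `vH` are
inner products of the vectors `∇b`, `∇v`, `∇P`, `∇ΔP` and `∇_z u`, abbreviated `g`, `v`, `G`, `H`
and `U`. -/
lemma remainder_le {t T b χ κ L B ℓ M v Uy d σ h gU GU gG vG gH vH g2 ε : ℝ}
    (hT : 0 < T) (ht : 0 ≤ t) (hb0 : 0 ≤ b) (hb1 : b ≤ 1) (hχ0 : 0 ≤ χ) (hχ1 : χ ≤ 1)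
    (hκ : 0 ≤ κ) (hL : 0 ≤ L) (hℓ : 1 ≤ ℓ) (hσ : 0 ≤ σ) (hh : 0 ≤ h) (hε : 0 < ε)
    (hgU : |gU| ≤ κ * σ) (hGU : |GU| ≤ L * σ) (hgG : |gG| ≤ κ * L)
    (hvG : |vG| ≤ (1 + L) * σ * L) (hgH : |gH| ≤ κ * h) (hvH : |vH| ≤ (1 + L) * σ * h)
    (hg0 : 0 ≤ g2) (hg2 : g2 ≤ L ^ 2) (hUy : |Uy| ≤ σ) (hv : |v| ≤ M) (htd : |t * d| ≤ B) :
    -(2 * t * b * χ ^ 2 * gU * v * (ℓ + t * d))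
      - 2 * t * b ^ 2 * χ / T * v * (GU - Uy)
      + b ^ 2 * χ ^ 2 * (1 + g2) * v * (t * d) * Uy / ℓ
      - v ^ 2 * b ^ 2 * χ / T * (1 + g2) / ℓ
      - 2 / ℓ * (t * d) * (b * χ ^ 2 * gG * v ^ 2 + b ^ 2 * χ ^ 2 * v * vG
          + b ^ 2 * χ ^ 2 * (v ^ 2 / 2) * d)
      - b * χ ^ 2 * gG * v ^ 2
      - t * b ^ 2 * χ / T * d * v ^ 2
      + t * b ^ 2 * χ ^ 2 * d * v * (ℓ + t * d) * Uy
      - t ^ 2 * b * χ ^ 2 * gH * v ^ 2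
      - t ^ 2 * b ^ 2 * χ ^ 2 * v * vH
    ≤ ε * (t * (b ^ 2 * χ ^ 2) * σ ^ 2)
      + (3 * (3 * (1 + L) ^ 2 + 2 * (ℓ + B)) ^ 2 / (4 * ε)
          + 3 / 2 * (3 * (1 + L) ^ 2 + 2 * (ℓ + B))) * M ^ 2
        * (t * (κ + 1 / T) ^ 2 + t * (b ^ 2 * χ ^ 2) * d ^ 2
          + t ^ 3 * (b ^ 2 * χ ^ 2) * h ^ 2)
      + (1 + L + B) * M ^ 2 * (κ + 1 / T) := by
  have hM : 0 ≤ M := (abs_nonneg _).trans hv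
  have hB : 0 ≤ B := (abs_nonneg _).trans htd
  have hv2 : v ^ 2 ≤ M ^ 2 := by
    rw [← sq_abs]; exact pow_le_pow_left₀ (abs_nonneg _) hv 2
  have hJ : |ℓ + t * d| ≤ ℓ + B := by
    refine (abs_add_le _ _).trans ?_
    rw [abs_of_pos (by linarith)]
    linarith
  have hℓ' : 1 / ℓ ≤ 1 := by rw [div_le_one (by linarith)]; exact hℓ
  have hb2 : b ^ 2 ≤ b := by nlinarith
  have hχ2 : χ ^ 2 ≤ χ := by nlinarith
  have hχ21 : χ ^ 2 ≤ 1 := by nlinarith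
  have hiT : 0 < 1 / T := by positivity
  have hgv : |gG * v ^ 2| ≤ κ * L * M ^ 2 := by
    rw [abs_mul, abs_of_nonneg (sq_nonneg v)]
    gcongr
  have hvJ : |v * (ℓ + t * d)| ≤ M * (ℓ + B) := by
    rw [abs_mul]; gcongr
  have e1 : -(2 * t * b * χ ^ 2 * gU * v * (ℓ + t * d))
      ≤ t * (b * χ * σ) * M * (2 * (ℓ + B) * κ) := by
    calc _ = -((2 * t * b * χ ^ 2) * gU * (v * (ℓ + t * d))) := by ring
      _ ≤ (2 * t * b * χ ^ 2) * (κ * σ) * (M * (ℓ + B)) :=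
        (neg_le_abs _).trans (abs_mul_mul_le (by positivity) hgU hvJ)
      _ ≤ (2 * t * b * χ) * (κ * σ) * (M * (ℓ + B)) := by gcongr
      _ = _ := by ring
  have e2 : -(2 * t * b ^ 2 * χ / T * v * (GU - Uy))
      ≤ t * (b * χ * σ) * M * (2 * (1 + L) * (1 / T)) := by
    have : |GU - Uy| ≤ (1 + L) * σ := by
      refine (abs_sub _ _).trans ?_
      linarith
    calc _ ≤ (2 * t * b ^ 2 * χ / T) * M * ((1 + L) * σ) :=
        (neg_le_abs _).trans (abs_mul_mul_le (by positivity) hv this)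
      _ ≤ (2 * t * b * χ / T) * M * ((1 + L) * σ) := by gcongr
      _ = _ := by ring
  have e3 : b ^ 2 * χ ^ 2 * (1 + g2) * v * (t * d) * Uy / ℓ
      ≤ t * (b * χ * σ) * M * ((1 + L) ^ 2 * (b * χ * |d|)) := by
    have h1 : |v * d| ≤ M * |d| := by rw [abs_mul]; gcongr
    calc _ = (b ^ 2 * χ ^ 2 * (1 + g2) * t * (1 / ℓ)) * (v * d) * Uy := by ring
      _ ≤ (b ^ 2 * χ ^ 2 * (1 + g2) * t * (1 / ℓ)) * (M * |d|) * σ :=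
        (le_abs_self _).trans (abs_mul_mul_le (by positivity) h1 hUy)
      _ ≤ (b ^ 2 * χ ^ 2 * (1 + L) ^ 2 * t * 1) * (M * |d|) * σ := by
        have : 1 + g2 ≤ (1 + L) ^ 2 := by nlinarith
        gcongr
      _ = _ := by ring
  have e4 : 0 ≤ v ^ 2 * b ^ 2 * χ / T * (1 + g2) / ℓ := by positivity
  have e5 : -(2 / ℓ * (t * d) * (b * χ ^ 2 * gG * v ^ 2 + b ^ 2 * χ ^ 2 * v * vG
          + b ^ 2 * χ ^ 2 * (v ^ 2 / 2) * d))
      ≤ t * M ^ 2 * (2 * (1 + L) * (b * χ * |d|) * κ + (b * χ * |d|) ^ 2)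
        + t * (b * χ * σ) * M * (2 * (1 + L) ^ 2 * (b * χ * |d|)) := by
    have f1 : -((2 * b * χ ^ 2 * t * (1 / ℓ)) * d * (gG * v ^ 2))
        ≤ t * M ^ 2 * (2 * (1 + L) * (b * χ * |d|) * κ) := by
      calc _ ≤ (2 * b * χ ^ 2 * t * (1 / ℓ)) * |d| * (κ * L * M ^ 2) :=
            (neg_le_abs _).trans (abs_mul_mul_le (by positivity) le_rfl hgv)
        _ ≤ (2 * b * χ * t * 1) * |d| * (κ * (1 + L) * M ^ 2) := by
          gcongr
          linarith
        _ = _ := by ring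
    have f2 : -((2 * b ^ 2 * χ ^ 2 * t * (1 / ℓ)) * (v * d) * vG)
        ≤ t * (b * χ * σ) * M * (2 * (1 + L) ^ 2 * (b * χ * |d|)) := by
      have h1 : |v * d| ≤ M * |d| := by rw [abs_mul]; gcongr
      calc _ ≤ (2 * b ^ 2 * χ ^ 2 * t * (1 / ℓ)) * (M * |d|) * ((1 + L) * σ * L) :=
            (neg_le_abs _).trans (abs_mul_mul_le (by positivity) h1 hvG)
        _ ≤ (2 * b ^ 2 * χ ^ 2 * t * 1) * (M * |d|) * ((1 + L) * σ * (1 + L)) := by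
          gcongr
          linarith
        _ = _ := by ring
    have f3 : -((b ^ 2 * χ ^ 2 * t * (1 / ℓ)) * v ^ 2 * d ^ 2)
        ≤ t * M ^ 2 * (b * χ * |d|) ^ 2 := by
      have : 0 ≤ (b ^ 2 * χ ^ 2 * t * (1 / ℓ)) * v ^ 2 * d ^ 2 := by positivity
      have : 0 ≤ t * M ^ 2 * (b * χ * |d|) ^ 2 := by positivity
      linarith
    calc _ = -((2 * b * χ ^ 2 * t * (1 / ℓ)) * d * (gG * v ^ 2))
          + -((2 * b ^ 2 * χ ^ 2 * t * (1 / ℓ)) * (v * d) * vG)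
          + -((b ^ 2 * χ ^ 2 * t * (1 / ℓ)) * v ^ 2 * d ^ 2) := by ring
      _ ≤ _ := by linarith
  have e6 : -(b * χ ^ 2 * gG * v ^ 2) ≤ (1 + L) * M ^ 2 * κ := by
    calc _ ≤ |(b * χ ^ 2) * 1 * (gG * v ^ 2)| := by
          rw [mul_one, mul_assoc (b * χ ^ 2)]; exact neg_le_abs _
      _ ≤ (b * χ ^ 2) * 1 * (κ * L * M ^ 2) :=
          abs_mul_mul_le (by positivity) (by simp) hgv
      _ ≤ (1 * 1) * 1 * (κ * (1 + L) * M ^ 2) := by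
          gcongr
          linarith
      _ = _ := by ring
  have e7 : -(t * b ^ 2 * χ / T * d * v ^ 2) ≤ B * M ^ 2 * (1 / T) := by
    calc _ = -((b ^ 2 * χ / T) * (t * d) * v ^ 2) := by ring
      _ ≤ (b ^ 2 * χ / T) * B * M ^ 2 :=
          (neg_le_abs _).trans (abs_mul_mul_le (by positivity) htd
            (by rwa [abs_of_nonneg (sq_nonneg v)]))
      _ ≤ (1 * 1 / T) * B * M ^ 2 := by
          have : b ^ 2 ≤ 1 := by linarith
          gcongr
      _ = _ := by ring
  have e8 : t * b ^ 2 * χ ^ 2 * d * v * (ℓ + t * d) * Uy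
      ≤ t * (b * χ * σ) * M * ((ℓ + B) * (b * χ * |d|)) := by
    have h1 : |d * Uy| ≤ |d| * σ := by rw [abs_mul]; gcongr
    calc _ = (t * b ^ 2 * χ ^ 2) * (v * (ℓ + t * d)) * (d * Uy) := by ring
      _ ≤ (t * b ^ 2 * χ ^ 2) * (M * (ℓ + B)) * (|d| * σ) :=
          (le_abs_self _).trans (abs_mul_mul_le (by positivity) hvJ h1)
      _ = _ := by ring
  have e9 : -(t ^ 2 * b * χ ^ 2 * gH * v ^ 2) ≤ t * M ^ 2 * ((t * b * χ * h) * κ) := by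
    calc _ ≤ (t ^ 2 * b * χ ^ 2) * (κ * h) * M ^ 2 :=
          (neg_le_abs _).trans (abs_mul_mul_le (by positivity) hgH
            (by rwa [abs_of_nonneg (sq_nonneg v)]))
      _ ≤ (t ^ 2 * b * χ) * (κ * h) * M ^ 2 := by gcongr
      _ = _ := by ring
  have e10 : -(t ^ 2 * b ^ 2 * χ ^ 2 * v * vH)
      ≤ t * (b * χ * σ) * M * ((1 + L) * (t * b * χ * h)) := by
    calc _ ≤ (t ^ 2 * b ^ 2 * χ ^ 2) * M * ((1 + L) * σ * h) :=
          (neg_le_abs _).trans (abs_mul_mul_le (by positivity) hv hvH)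
      _ = _ := by ring
  have rw1 : t * (b ^ 2 * χ ^ 2) * σ ^ 2 = t * (b * χ * σ) ^ 2 := by ring
  have rw2 : t * (b ^ 2 * χ ^ 2) * d ^ 2 = t * (b * χ * |d|) ^ 2 := by
    rw [← sq_abs d]; ring
  have rw3 : t ^ 3 * (b ^ 2 * χ ^ 2) * h ^ 2 = t * (t * b * χ * h) ^ 2 := by ring
  rw [rw1, rw2, rw3]
  have := weighted_young_le (t := t) (κ := κ) (τ := 1 / T) (L := L) (B := B) (ℓ := ℓ) (M := M)
    (s := b * χ * σ) (δ := b * χ * |d|) (y := t * b * χ * h) (ε := ε) ht hκ hiT.le hL hℓ hB hM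
    (by positivity) (by positivity) (by positivity) hε
  linarith

end

end LipschitzGraph

namespace LipschitzGraph

noncomputable section

open Set Metric

variable {n : ℕ}

/-- The first two derivatives of a bounded function `u` in the flattened coordinates
`y = P(z, t) + ℓ t`: `v`, `U`, `Uy`, `Y` and `Ly` stand for `u`, `∇_z u`, `∂_y u`, `∇_z ∂_y u` and
`∂_y² u` at the point `(z, P(z, t) + ℓ t)`, `U'` is the spatial derivative of `U`, and `Lz` stands
for `Δ_z u`. The function satisfies `|u Δu| ≤ θ |∇u|²`. -/
structure FlatSolution {L B : ℝ} (F : CaloricExtension n L B) (ℓ θ M T : ℝ) where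
  v : Base n → ℝ → ℝ
  U : Base n → ℝ → Base n
  Uy : Base n → ℝ → ℝ
  Y : Base n → ℝ → Base n
  Ly : Base n → ℝ → ℝ
  Lz : Base n → ℝ → ℝ
  U' : Base n → ℝ → Base n →L[ℝ] Base n
  continuous_v : Continuous fun p : Base n × ℝ => v p.1 p.2
  continuous_U : Continuous fun p : Base n × ℝ => U p.1 p.2
  continuous_Uy : Continuous fun p : Base n × ℝ => Uy p.1 p.2
  continuous_Y : Continuous fun p : Base n × ℝ => Y p.1 p.2
  continuous_Ly : Continuous fun p : Base n × ℝ => Ly p.1 p.2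
  continuous_U' : Continuous fun p : Base n × ℝ => U' p.1 p.2
  grad_v : ∀ z, ∀ t ∈ Ioo 0 T, HasGradientAt (v · t) (U z t + Uy z t • F.G z t) z
  deriv_v : ∀ z, ∀ t ∈ Ioo 0 T, HasDerivAt (v z) ((ℓ + t * F.D z t) * Uy z t) t
  fderiv_U : ∀ z, ∀ t ∈ Ioo 0 T, HasFDerivAt (U · t) (U' z t) z
  tr_U' : ∀ z t, tr (U' z t) = Lz z t + inner ℝ (F.G z t) (Y z t)
  deriv_U : ∀ z, ∀ t ∈ Ioo 0 T, HasDerivAt (U z) ((ℓ + t * F.D z t) • Y z t) t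
  deriv_Uy : ∀ z, ∀ t ∈ Ioo 0 T, HasDerivAt (Uy z) ((ℓ + t * F.D z t) * Ly z t) t
  abs_v : ∀ z t, |v z t| ≤ M
  sharp : ∀ z t, |v z t * (Lz z t + Ly z t)| ≤ θ * (‖U z t‖ ^ 2 + Uy z t ^ 2)

attribute [fun_prop] FlatSolution.continuous_v FlatSolution.continuous_U FlatSolution.continuous_Uy
  FlatSolution.continuous_Y FlatSolution.continuous_Ly FlatSolution.continuous_U'

/-- The constant of the energy estimate `FlatSolution.integral_energy_le`; the parameter `q`
stands for `1 + κT`, where `κ` bounds the gradient of the cutoff. -/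
def energyConst (L B ℓ θ q : ℝ) : ℝ :=
  2 / (1 - θ) * ((1 + L) ^ 2
    + (3 * (3 * (1 + L) ^ 2 + 2 * (ℓ + B)) ^ 2 / (2 * (1 - θ))
        + 3 / 2 * (3 * (1 + L) ^ 2 + 2 * (ℓ + B)))
      * (q ^ 2 + 3 * (1 + 4 * q ^ 2) * L ^ 2 + 4 * q ^ 2 * B ^ 2)
    + (1 + L + B) * q)

variable {z₀ : Base n} {R κ L B ℓ θ M T : ℝ} {F : CaloricExtension n L B}

/-- The first divergence term, the field `t β² v J U`. -/
def FlatSolution.divA (u : FlatSolution F ℓ θ M T) (η : Cutoff z₀ R κ) (p : Base n × ℝ) : ℝ :=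
  inner ℝ (η.sq T p.1 p.2 • (p.2 • ((u.v p.1 p.2) • (p.2 • F.H p.1 p.2)
        + (ℓ + p.2 * F.D p.1 p.2) • (u.U p.1 p.2 + u.Uy p.1 p.2 • F.G p.1 p.2)))
      + (p.2 * (u.v p.1 p.2 * (ℓ + p.2 * F.D p.1 p.2))) •
        ((2 * η.b p.1 * (1 - p.2 / T) ^ 2) • η.b' p.1)) (u.U p.1 p.2)
    + η.sq T p.1 p.2 * (p.2 * (u.v p.1 p.2 * (ℓ + p.2 * F.D p.1 p.2))) * tr (u.U' p.1 p.2)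

lemma FlatSolution.integral_divA (u : FlatSolution F ℓ θ M T) (η : Cutoff z₀ R κ) :
    Integrable (u.divA η) (slab z₀ R T) ∧ ∫ p, u.divA η p ∂slab z₀ R T = 0 := by
  have c1 : Continuous fun p : Base n × ℝ => tr (u.U' p.1 p.2) := continuous_tr.comp u.continuous_U'
  refine ⟨integrable_slab (by unfold FlatSolution.divA; fun_prop) _ _ _, ?_⟩
  exact integral_slab_div (z₀ := z₀) (R := R) (T := T)
    (f := fun z t => η.sq T z t * (t * (u.v z t * (ℓ + t * F.D z t))))
    (f' := fun z t => η.sq T z t • (t • ((u.v z t) • (t • F.H z t)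
        + (ℓ + t * F.D z t) • (u.U z t + u.Uy z t • F.G z t)))
      + (t * (u.v z t * (ℓ + t * F.D z t))) • ((2 * η.b z * (1 - t / T) ^ 2) • η.b' z))
    (F := u.U) (F' := u.U') (by fun_prop) (by fun_prop) (by fun_prop) (by fun_prop)
    (fun z hz t => by simp [η.sq_eq_zero T hz])
    (fun z t ht => hasGradientAt_mul (η.grad_sq T z t) (hasGradientAt_const_mul t
      (hasGradientAt_mul (u.grad_v z t ht)
        (hasGradientAt_const_add ℓ (hasGradientAt_const_mul t (F.grad_D z t))))))
    (fun z t ht => u.fderiv_U z t ht)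

lemma FlatSolution.grad_sq (u : FlatSolution F ℓ θ M T) (z : Base n) (t : ℝ) (ht : t ∈ Ioo 0 T) :
    HasGradientAt (fun z => u.v z t ^ 2 / 2)
      (u.v z t • (u.U z t + u.Uy z t • F.G z t)) z := by
  have := hasGradientAt_const_mul (1 / 2) (hasGradientAt_mul (u.grad_v z t ht) (u.grad_v z t ht))
  convert this using 1
  · funext y; ring
  · module

lemma FlatSolution.deriv_sq (u : FlatSolution F ℓ θ M T) (z : Base n) (t : ℝ) (ht : t ∈ Ioo 0 T) :
    HasDerivAt (fun t => u.v z t ^ 2 / 2)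
      (u.v z t * ((ℓ + t * F.D z t) * u.Uy z t)) t := by
  refine (((u.deriv_v z t ht).pow 2).div_const 2).congr_deriv ?_
  simp
  ring

/-- The second divergence term, the field `β² (v² / 2) (1 + 2 t D / ℓ) G`. -/
def FlatSolution.divB (u : FlatSolution F ℓ θ M T) (η : Cutoff z₀ R κ) (p : Base n × ℝ) : ℝ :=
  inner ℝ (η.sq T p.1 p.2 • ((u.v p.1 p.2 ^ 2 / 2) • ((2 * p.2 / ℓ) • F.H p.1 p.2)
        + (1 + 2 * p.2 / ℓ * F.D p.1 p.2) •
          (u.v p.1 p.2 • (u.U p.1 p.2 + u.Uy p.1 p.2 • F.G p.1 p.2)))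
      + (u.v p.1 p.2 ^ 2 / 2 * (1 + 2 * p.2 / ℓ * F.D p.1 p.2)) •
        ((2 * η.b p.1 * (1 - p.2 / T) ^ 2) • η.b' p.1)) (F.G p.1 p.2)
    + η.sq T p.1 p.2 * (u.v p.1 p.2 ^ 2 / 2 * (1 + 2 * p.2 / ℓ * F.D p.1 p.2))
      * tr (F.G' p.1 p.2)

lemma FlatSolution.integral_divB (u : FlatSolution F ℓ θ M T) (η : Cutoff z₀ R κ) :
    Integrable (u.divB η) (slab z₀ R T) ∧ ∫ p, u.divB η p ∂slab z₀ R T = 0 := by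
  have c1 : Continuous fun p : Base n × ℝ => tr (F.G' p.1 p.2) := continuous_tr.comp F.continuous_G'
  refine ⟨integrable_slab (by unfold FlatSolution.divB; fun_prop) _ _ _, ?_⟩
  exact integral_slab_div (z₀ := z₀) (R := R) (T := T)
    (f := fun z t => η.sq T z t * (u.v z t ^ 2 / 2 * (1 + 2 * t / ℓ * F.D z t)))
    (f' := fun z t => η.sq T z t • ((u.v z t ^ 2 / 2) • ((2 * t / ℓ) • F.H z t)
        + (1 + 2 * t / ℓ * F.D z t) • (u.v z t • (u.U z t + u.Uy z t • F.G z t)))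
      + (u.v z t ^ 2 / 2 * (1 + 2 * t / ℓ * F.D z t)) •
        ((2 * η.b z * (1 - t / T) ^ 2) • η.b' z))
    (F := F.G) (F' := F.G') (by fun_prop) (by fun_prop) (by fun_prop) (by fun_prop)
    (fun z hz t => by simp [η.sq_eq_zero T hz])
    (fun z t ht => hasGradientAt_mul (η.grad_sq T z t)
      (hasGradientAt_mul (u.grad_sq z t ht)
        (hasGradientAt_const_add 1 (hasGradientAt_const_mul (2 * t / ℓ) (F.grad_D z t)))))
    (fun z t ht => F.fderiv_G z t)

/-- The third divergence term, the field `t² β² (v² / 2) H`. -/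
def FlatSolution.divC (u : FlatSolution F ℓ θ M T) (η : Cutoff z₀ R κ) (p : Base n × ℝ) : ℝ :=
  inner ℝ (η.sq T p.1 p.2 • (p.2 ^ 2 •
          (u.v p.1 p.2 • (u.U p.1 p.2 + u.Uy p.1 p.2 • F.G p.1 p.2)))
      + (p.2 ^ 2 * (u.v p.1 p.2 ^ 2 / 2)) •
        ((2 * η.b p.1 * (1 - p.2 / T) ^ 2) • η.b' p.1)) (F.H p.1 p.2)
    + η.sq T p.1 p.2 * (p.2 ^ 2 * (u.v p.1 p.2 ^ 2 / 2)) * tr (F.H' p.1 p.2)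

lemma FlatSolution.integral_divC (u : FlatSolution F ℓ θ M T) (η : Cutoff z₀ R κ) :
    Integrable (u.divC η) (slab z₀ R T) ∧ ∫ p, u.divC η p ∂slab z₀ R T = 0 := by
  have c1 : Continuous fun p : Base n × ℝ => tr (F.H' p.1 p.2) := continuous_tr.comp F.continuous_H'
  refine ⟨integrable_slab (by unfold FlatSolution.divC; fun_prop) _ _ _, ?_⟩
  exact integral_slab_div (z₀ := z₀) (R := R) (T := T)
    (f := fun z t => η.sq T z t * (t ^ 2 * (u.v z t ^ 2 / 2)))
    (f' := fun z t => η.sq T z t • (t ^ 2 • (u.v z t • (u.U z t + u.Uy z t • F.G z t)))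
      + (t ^ 2 * (u.v z t ^ 2 / 2)) • ((2 * η.b z * (1 - t / T) ^ 2) • η.b' z))
    (F := F.H) (F' := F.H') (by fun_prop) (by fun_prop) (by fun_prop) (by fun_prop)
    (fun z hz t => by simp [η.sq_eq_zero T hz])
    (fun z t ht => hasGradientAt_mul (η.grad_sq T z t)
      (hasGradientAt_const_mul (t ^ 2) (u.grad_sq z t ht)))
    (fun z t ht => F.fderiv_H z t)

/-- The density whose time derivative enters the energy identity. Its last two terms turn
`v ∂_y u` and `v² ΔP`, which are not controlled by Carleson estimates, into controlled ones. -/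
def FlatSolution.bdry (u : FlatSolution F ℓ θ M T) (η : Cutoff z₀ R κ) (z : Base n) (t : ℝ) : ℝ :=
  η.sq T z t * (t * (u.v z t * (u.Uy z t - inner ℝ (F.G z t) (u.U z t)))
    - (u.v z t ^ 2 / 2) * ((1 + ‖F.G z t‖ ^ 2) / ℓ + t * F.D z t))

/-- The time derivative of `FlatSolution.bdry`. -/
def FlatSolution.bdry' (u : FlatSolution F ℓ θ M T) (η : Cutoff z₀ R κ) (z : Base n) (t : ℝ) : ℝ :=
  -(2 / T * η.b z ^ 2 * (1 - t / T))
      * (t * (u.v z t * (u.Uy z t - inner ℝ (F.G z t) (u.U z t)))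
        - (u.v z t ^ 2 / 2) * ((1 + ‖F.G z t‖ ^ 2) / ℓ + t * F.D z t))
    + η.sq T z t * ((u.v z t * (u.Uy z t - inner ℝ (F.G z t) (u.U z t))
        + t * ((ℓ + t * F.D z t) * u.Uy z t * (u.Uy z t - inner ℝ (F.G z t) (u.U z t))
          + u.v z t * ((ℓ + t * F.D z t) * u.Ly z t
            - (inner ℝ (F.G z t) ((ℓ + t * F.D z t) • u.Y z t)
              + inner ℝ (t • F.H z t) (u.U z t)))))
      - (u.v z t * ((ℓ + t * F.D z t) * u.Uy z t) * ((1 + ‖F.G z t‖ ^ 2) / ℓ + t * F.D z t)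
        + (u.v z t ^ 2 / 2) * (2 * inner ℝ (F.G z t) (t • F.H z t) / ℓ
          + (F.D z t + t * (t * F.K z t)))))

lemma FlatSolution.integral_bdry' (u : FlatSolution F ℓ θ M T) (η : Cutoff z₀ R κ) (hT : 0 < T)
    (hℓ : 1 ≤ ℓ) :
    Integrable (fun p : Base n × ℝ => u.bdry' η p.1 p.2) (slab z₀ R T) ∧
      ∫ p, u.bdry' η p.1 p.2 ∂slab z₀ R T
        ≤ (1 + L) ^ 2 * M ^ 2 * volume.real (closedBall z₀ R) := by
  have hc : Continuous fun p : Base n × ℝ => u.bdry' η p.1 p.2 := by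
    unfold FlatSolution.bdry'; fun_prop
  refine ⟨integrable_slab hc _ _ _, ?_⟩
  rw [integral_slab_deriv (z₀ := z₀) (R := R) hT.le (f := u.bdry η) (f' := u.bdry' η)
    (by unfold FlatSolution.bdry; fun_prop) hc]
  · have : ∫ z in closedBall z₀ R, ((1 + L) ^ 2 * M ^ 2 : ℝ)
        = (1 + L) ^ 2 * M ^ 2 * volume.real (closedBall z₀ R) := by
      simp [mul_comm]
    rw [← this]
    have hG := F.continuous_G
    have hv := u.continuous_v
    have hUy := u.continuous_Uy
    have hU := u.continuous_U
    have hD := F.continuous_D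
    refine integral_mono ?_ (integrable_const _) fun z => ?_
    · refine ContinuousOn.integrableOn_compact (isCompact_closedBall z₀ R) ?_
      unfold FlatSolution.bdry
      fun_prop
    · simp only [FlatSolution.bdry, η.sq_end hT, η.sq_zero]
      have h1 : η.b z ^ 2 ≤ 1 := pow_le_one₀ (η.nonneg z) (η.le_one z)
      have h2 : ‖F.G z 0‖ ≤ L := F.norm_G z 0
      have hL : 0 ≤ L := (norm_nonneg _).trans h2
      have h3 : u.v z 0 ^ 2 ≤ M ^ 2 := by
        rw [← sq_abs]; exact pow_le_pow_left₀ (abs_nonneg _) (u.abs_v z 0) 2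
      calc _ = η.b z ^ 2 * (u.v z 0 ^ 2 * ((1 + ‖F.G z 0‖ ^ 2) * (1 / ℓ))) / 2 := by ring
        _ ≤ 1 * (M ^ 2 * ((1 + L) ^ 2 * 1)) / 2 := by
          have : 1 / ℓ ≤ 1 := by rw [div_le_one (by linarith)]; exact hℓ
          have : 1 + ‖F.G z 0‖ ^ 2 ≤ (1 + L) ^ 2 := by nlinarith [norm_nonneg (F.G z 0)]
          gcongr
        _ ≤ _ := by nlinarith [mul_nonneg (sq_nonneg M) (sq_nonneg (1 + L))]
  · intro z t ht
    have hi := ((F.deriv_G z t).inner ℝ (u.deriv_U z t ht))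
    have hG := (((F.deriv_G z t).norm_sq.const_add 1).div_const ℓ).add
      ((hasDerivAt_id t).mul (F.deriv_D z t))
    have hm := (hasDerivAt_id t).mul ((u.deriv_v z t ht).mul ((u.deriv_Uy z t ht).sub hi))
    have hw := (u.deriv_sq z t ht).mul hG
    refine ((η.deriv_sq T z t).mul (hm.sub hw)).congr_deriv ?_
    simp [FlatSolution.bdry']

/-- The energy identity, with its error terms bounded: the energy density is at most a sum of
divergences and of quantities controlled by the Carleson estimate.

Testing `u Δu` against `t β²` gives the divergence of `t β² v J U`, where `J = ℓ + t D`, a time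
derivative, and the terms `β² v ∂_y u` and `β² v ⟨G, U⟩` in which the weight `t` has been
differentiated. With `w = v² / 2` these are `β² w_t / J` and `β² ⟨G, ∇w⟩` up to
`β² |G|² w_t / J`, and `1 / J` is `1 / ℓ` up to a multiple of `t D`. Integrating by parts once more,
in time and in space, leaves `w ∂ₜ|G|² = 2 t w ⟨G, H⟩`, which the field `t β² w D G` removes, and
`w div G = w D`. The latter is linear in
`D`, so the Carleson estimate does not apply; it is `∂ₜ(t w D)` up to `t D w_t` and `t² w K`, and
`K = div H` makes the last term a divergence up to `t² ⟨H, ∇w⟩`. -/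
lemma FlatSolution.energy_density_le (u : FlatSolution F ℓ θ M T) (η : Cutoff z₀ R κ)
    (hℓ : 1 + B ≤ ℓ) (hθ : θ < 1) {z : Base n} {t : ℝ} (ht : 0 ≤ t)
    (htT : t ≤ T) (hT : 0 < T) :
    (1 - θ) / 2 * (t * η.sq T z t * (ℓ + t * F.D z t) * (‖u.U z t‖ ^ 2 + u.Uy z t ^ 2))
      ≤ u.divA η (z, t) + u.divB η (z, t) + u.divC η (z, t) + u.bdry' η z t
        + (3 * (3 * (1 + L) ^ 2 + 2 * (ℓ + B)) ^ 2 / (2 * (1 - θ))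
          + 3 / 2 * (3 * (1 + L) ^ 2 + 2 * (ℓ + B))) * M ^ 2
          * (T * (κ + 1 / T) ^ 2 + t * η.sq T z t * F.D z t ^ 2
            + t ^ 3 * η.sq T z t * ‖F.H z t‖ ^ 2)
        + (1 + L + B) * M ^ 2 * (κ + 1 / T) := by
  have hL : 0 ≤ L := (norm_nonneg _).trans (F.norm_G z t)
  have hκ : 0 ≤ κ := (norm_nonneg _).trans (η.norm_b' z)
  have hB : 0 ≤ B := (abs_nonneg _).trans (F.abs_D z t)
  have hℓ1 : 1 ≤ ℓ := by linarith
  have hsharp := (abs_le.1 (u.sharp z t)).1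
  have hχ0 : 0 ≤ 1 - t / T := by
    rw [sub_nonneg, div_le_one hT]; exact htT
  have hχ1 : 1 - t / T ≤ 1 := by
    have : 0 ≤ t / T := by positivity
    linarith
  have hJ : 1 ≤ ℓ + t * F.D z t := by
    have := (abs_le.1 (F.abs_D z t)).1
    linarith
  set σ := Real.sqrt (‖u.U z t‖ ^ 2 + u.Uy z t ^ 2) with hσ
  have hσ2 : σ ^ 2 = ‖u.U z t‖ ^ 2 + u.Uy z t ^ 2 := Real.sq_sqrt (by positivity)
  have hσ0 : 0 ≤ σ := Real.sqrt_nonneg _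
  have hUσ : ‖u.U z t‖ ≤ σ := Real.le_sqrt_of_sq_le (by nlinarith [sq_nonneg (u.Uy z t)])
  have hUyσ : |u.Uy z t| ≤ σ := Real.abs_le_sqrt (by nlinarith [sq_nonneg ‖u.U z t‖])
  have hgv : ‖u.U z t + u.Uy z t • F.G z t‖ ≤ (1 + L) * σ := by
    refine (norm_add_le _ _).trans ?_
    rw [norm_smul, Real.norm_eq_abs]
    have : |u.Uy z t| * ‖F.G z t‖ ≤ σ * L :=
      mul_le_mul hUyσ (F.norm_G z t) (norm_nonneg _) hσ0
    linarith
  have hr := remainder_le (t := t) (T := T) (b := η.b z) (χ := 1 - t / T) (κ := κ) (L := L) (B := B)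
    (ℓ := ℓ) (M := M) (v := u.v z t) (Uy := u.Uy z t) (d := F.D z t) (σ := σ) (h := ‖F.H z t‖)
    (gU := inner ℝ (η.b' z) (u.U z t)) (GU := inner ℝ (F.G z t) (u.U z t))
    (gG := inner ℝ (η.b' z) (F.G z t))
    (vG := inner ℝ (u.U z t + u.Uy z t • F.G z t) (F.G z t))
    (gH := inner ℝ (η.b' z) (F.H z t))
    (vH := inner ℝ (u.U z t + u.Uy z t • F.G z t) (F.H z t)) (g2 := ‖F.G z t‖ ^ 2)
    (ε := (1 - θ) / 2) hT ht (η.nonneg z) (η.le_one z) hχ0 hχ1 hκ hL hℓ1 hσ0 (norm_nonneg _)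
    (by linarith)
    ((abs_real_inner_le_norm _ _).trans (mul_le_mul (η.norm_b' z) hUσ (norm_nonneg _) hκ))
    ((abs_real_inner_le_norm _ _).trans (mul_le_mul (F.norm_G z t) hUσ (norm_nonneg _) hL))
    ((abs_real_inner_le_norm _ _).trans
      (mul_le_mul (η.norm_b' z) (F.norm_G z t) (norm_nonneg _) hκ))
    ((abs_real_inner_le_norm _ _).trans
      (mul_le_mul hgv (F.norm_G z t) (norm_nonneg _) (by positivity)))
    ((abs_real_inner_le_norm _ _).trans
      (mul_le_mul_of_nonneg_right (η.norm_b' z) (norm_nonneg _)))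
    ((abs_real_inner_le_norm _ _).trans (mul_le_mul_of_nonneg_right hgv (norm_nonneg _)))
    (sq_nonneg _) (pow_le_pow_left₀ (norm_nonneg _) (F.norm_G z t) 2) hUyσ (u.abs_v z t)
    (F.abs_D z t)
  -- The energy identity; the bracket collects the terms estimated by `remainder_le`.
  have hid : t * η.sq T z t * (ℓ + t * F.D z t)
        * (‖u.U z t‖ ^ 2 + u.Uy z t ^ 2 + u.v z t * (u.Lz z t + u.Ly z t))
      = u.divA η (z, t) + u.divB η (z, t) + u.divC η (z, t) + u.bdry' η z t
        + (-(2 * t * η.b z * (1 - t / T) ^ 2 * inner ℝ (η.b' z) (u.U z t) * u.v z t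
            * (ℓ + t * F.D z t))
          - 2 * t * η.b z ^ 2 * (1 - t / T) / T * u.v z t
            * (inner ℝ (F.G z t) (u.U z t) - u.Uy z t)
          + η.b z ^ 2 * (1 - t / T) ^ 2 * (1 + ‖F.G z t‖ ^ 2) * u.v z t * (t * F.D z t)
            * u.Uy z t / ℓ
          - u.v z t ^ 2 * η.b z ^ 2 * (1 - t / T) / T * (1 + ‖F.G z t‖ ^ 2) / ℓ
          - 2 / ℓ * (t * F.D z t) * (η.b z * (1 - t / T) ^ 2 * inner ℝ (η.b' z) (F.G z t)
              * u.v z t ^ 2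
            + η.b z ^ 2 * (1 - t / T) ^ 2 * u.v z t
              * inner ℝ (u.U z t + u.Uy z t • F.G z t) (F.G z t)
            + η.b z ^ 2 * (1 - t / T) ^ 2 * (u.v z t ^ 2 / 2) * F.D z t)
          - η.b z * (1 - t / T) ^ 2 * inner ℝ (η.b' z) (F.G z t) * u.v z t ^ 2
          - t * η.b z ^ 2 * (1 - t / T) / T * F.D z t * u.v z t ^ 2
          + t * η.b z ^ 2 * (1 - t / T) ^ 2 * F.D z t * u.v z t * (ℓ + t * F.D z t) * u.Uy z t
          - t ^ 2 * η.b z * (1 - t / T) ^ 2 * inner ℝ (η.b' z) (F.H z t) * u.v z t ^ 2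
          - t ^ 2 * η.b z ^ 2 * (1 - t / T) ^ 2 * u.v z t
            * inner ℝ (u.U z t + u.Uy z t • F.G z t) (F.H z t)) := by
    have hℓ0 : ℓ ≠ 0 := by positivity
    simp only [FlatSolution.divA, FlatSolution.divB, FlatSolution.divC, FlatSolution.bdry',
      Cutoff.sq, inner_add_left, inner_smul_left, inner_smul_right, conj_trivial, smul_smul,
      real_inner_self_eq_norm_sq, u.tr_U', F.tr_G', F.tr_H',
      real_inner_comm (F.G z t) (u.U z t), real_inner_comm (F.G z t) (F.H z t),
      real_inner_comm (F.H z t) (u.U z t)]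
    generalize 1 - t / T = χ
    field_simp
    ring
  rw [hσ2] at hr
  have hw0 : 0 ≤ t * η.sq T z t := by unfold Cutoff.sq; positivity
  have hw : 0 ≤ t * η.sq T z t * (ℓ + t * F.D z t) := mul_nonneg hw0 (by linarith)
  have hs := mul_le_mul_of_nonneg_left hsharp hw
  have hS : 0 ≤ ‖u.U z t‖ ^ 2 + u.Uy z t ^ 2 := by positivity
  have hlow : t * η.sq T z t * (‖u.U z t‖ ^ 2 + u.Uy z t ^ 2)
      ≤ t * η.sq T z t * (ℓ + t * F.D z t) * (‖u.U z t‖ ^ 2 + u.Uy z t ^ 2) := by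
    exact mul_le_mul_of_nonneg_right (le_mul_of_one_le_right hw0 hJ) hS
  have hlow' := mul_le_mul_of_nonneg_left hlow (show 0 ≤ (1 - θ) / 2 by linarith)
  have hk : t * (κ + 1 / T) ^ 2 ≤ T * (κ + 1 / T) ^ 2 := by gcongr
  have hk' := mul_le_mul_of_nonneg_left hk
    (show 0 ≤ (3 * (3 * (1 + L) ^ 2 + 2 * (ℓ + B)) ^ 2 / (2 * (1 - θ))
          + 3 / 2 * (3 * (1 + L) ^ 2 + 2 * (ℓ + B))) * M ^ 2 by
      have : 0 < 1 - θ := by linarith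
      positivity)
  have e4 : 4 * ((1 - θ) / 2) = 2 * (1 - θ) := by ring
  rw [e4] at hr
  change _ ≤ (1 - θ) / 2 * (t * η.sq T z t * (‖u.U z t‖ ^ 2 + u.Uy z t ^ 2))
      + _ * (t * (κ + 1 / T) ^ 2 + t * η.sq T z t * F.D z t ^ 2
          + t ^ 3 * η.sq T z t * ‖F.H z t‖ ^ 2) + _ at hr
  linarith

/-- The energy estimate: integrate `FlatSolution.energy_density_le`. The divergences have no
integral, the time derivative is bounded by its initial values, and the remaining terms are bounded
by the Carleson estimates for the caloric extension. -/
lemma FlatSolution.integral_energy_le (u : FlatSolution F ℓ θ M T) (η : Cutoff z₀ R κ)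
    (hℓ : 1 + B ≤ ℓ) (hθ : θ < 1) (hT : 0 < T) :
    ∫ p, p.2 * η.sq T p.1 p.2 * (ℓ + p.2 * F.D p.1 p.2)
        * (‖u.U p.1 p.2‖ ^ 2 + u.Uy p.1 p.2 ^ 2) ∂slab z₀ R T
      ≤ energyConst L B ℓ θ (1 + κ * T) * M ^ 2 * volume.real (closedBall z₀ R) := by
  have hL : 0 ≤ L := (norm_nonneg _).trans (F.norm_G z₀ 0)
  have hκ : 0 ≤ κ := (norm_nonneg _).trans (η.norm_b' z₀)
  have hB : 0 ≤ B := (abs_nonneg _).trans (F.abs_D z₀ 0)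
  set V := volume.real (closedBall z₀ R)
  have hV : 0 ≤ V := measureReal_nonneg
  set C := 3 * (3 * (1 + L) ^ 2 + 2 * (ℓ + B)) ^ 2 / (2 * (1 - θ))
          + 3 / 2 * (3 * (1 + L) ^ 2 + 2 * (ℓ + B)) with hC
  have hC0 : 0 ≤ C := by
    have : 0 < 1 - θ := by linarith
    have : 0 ≤ ℓ := by linarith
    positivity
  have hmono : ∫ p, (1 - θ) / 2 * (p.2 * η.sq T p.1 p.2 * (ℓ + p.2 * F.D p.1 p.2)
        * (‖u.U p.1 p.2‖ ^ 2 + u.Uy p.1 p.2 ^ 2)) ∂slab z₀ R T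
      ≤ ∫ p, (u.divA η p + u.divB η p + u.divC η p + u.bdry' η p.1 p.2
        + C * M ^ 2 * (T * (κ + 1 / T) ^ 2 + p.2 * η.sq T p.1 p.2 * F.D p.1 p.2 ^ 2
            + p.2 ^ 3 * η.sq T p.1 p.2 * ‖F.H p.1 p.2‖ ^ 2)
        + (1 + L + B) * M ^ 2 * (κ + 1 / T)) ∂slab z₀ R T := by
    refine integral_mono_ae (integrable_slab (by fun_prop) _ _ _) ?_ ?_
    · exact (((((u.integral_divA η).1.add (u.integral_divB η).1).add (u.integral_divC η).1).add
        (u.integral_bdry' η hT (by linarith)).1).add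
        (integrable_slab (by fun_prop) _ _ _)).add (integrable_const _)
    · filter_upwards [ae_slab z₀ R T] with p hp
      exact u.energy_density_le η hℓ hθ hp.2.1 hp.2.2 hT
  have e1 := (u.integral_divA η)
  have e2 := (u.integral_divB η)
  have e3 := (u.integral_divC η)
  have e4 := (u.integral_bdry' η hT (by linarith))
  have i5 : Integrable (fun p : Base n × ℝ => p.2 * η.sq T p.1 p.2 * F.D p.1 p.2 ^ 2)
    (slab z₀ R T) := integrable_slab (by fun_prop) _ _ _
  have i6 : Integrable (fun p : Base n × ℝ => p.2 ^ 3 * η.sq T p.1 p.2 * ‖F.H p.1 p.2‖ ^ 2)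
    (slab z₀ R T) := integrable_slab (by fun_prop) _ _ _
  have i7 : Integrable (fun p : Base n × ℝ => T * (κ + 1 / T) ^ 2
      + p.2 * η.sq T p.1 p.2 * F.D p.1 p.2 ^ 2) (slab z₀ R T) := (integrable_const _).add i5
  have i8 : Integrable (fun p : Base n × ℝ => C * M ^ 2 * (T * (κ + 1 / T) ^ 2
      + p.2 * η.sq T p.1 p.2 * F.D p.1 p.2 ^ 2
      + p.2 ^ 3 * η.sq T p.1 p.2 * ‖F.H p.1 p.2‖ ^ 2)) (slab z₀ R T) := (i7.add i6).const_mul _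
  have i12 : Integrable (fun p => u.divA η p + u.divB η p) (slab z₀ R T) := e1.1.add e2.1
  have i13 : Integrable (fun p => u.divA η p + u.divB η p + u.divC η p) (slab z₀ R T) :=
    i12.add e3.1
  have i14 : Integrable (fun p => u.divA η p + u.divB η p + u.divC η p + u.bdry' η p.1 p.2)
    (slab z₀ R T) := i13.add e4.1
  have i15 : Integrable (fun p => u.divA η p + u.divB η p + u.divC η p + u.bdry' η p.1 p.2
      + C * M ^ 2 * (T * (κ + 1 / T) ^ 2 + p.2 * η.sq T p.1 p.2 * F.D p.1 p.2 ^ 2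
      + p.2 ^ 3 * η.sq T p.1 p.2 * ‖F.H p.1 p.2‖ ^ 2)) (slab z₀ R T) := i14.add i8
  rw [integral_add i15 (integrable_const _), integral_add i14 i8, integral_add i13 e4.1,
    integral_add i12 e3.1, integral_add e1.1 e2.1, e1.2, e2.2, e3.2, integral_const_mul,
    integral_const_mul, integral_add i7 i6, integral_add (integrable_const _) i5,
    integral_slab_const hT.le, integral_slab_const hT.le] at hmono
  have h5 := F.integral_D_sq_le η hT
  have h6 := F.integral_H_sq_le η hT
  set q := 1 + κ * T with hq
  have hq2 : (κ * T) ^ 2 ≤ q ^ 2 := by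
    have : 0 ≤ κ * T := by positivity
    rw [hq]; gcongr; linarith
  have hk1 : (κ + 1 / T) * (T * V) = q * V := by
    rw [hq]; field_simp; ring
  have hk2 : T * (κ + 1 / T) ^ 2 * (T * V) = q ^ 2 * V := by
    rw [hq]; field_simp; ring
  have h7 : T * (κ + 1 / T) ^ 2 * (T * V) + ∫ p, p.2 * η.sq T p.1 p.2 * F.D p.1 p.2 ^ 2 ∂slab z₀ R T
      + ∫ p, p.2 ^ 3 * η.sq T p.1 p.2 * ‖F.H p.1 p.2‖ ^ 2 ∂slab z₀ R T
      ≤ (q ^ 2 + 3 * (1 + 4 * q ^ 2) * L ^ 2 + 4 * q ^ 2 * B ^ 2) * V := by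
    have a1 : (1 + 4 * (κ * T) ^ 2) * L ^ 2 * V ≤ (1 + 4 * q ^ 2) * L ^ 2 * V := by gcongr
    have a2 : (2 * (1 + 4 * (κ * T) ^ 2) * L ^ 2 + 4 * (κ * T) ^ 2 * B ^ 2) * V
        ≤ (2 * (1 + 4 * q ^ 2) * L ^ 2 + 4 * q ^ 2 * B ^ 2) * V := by gcongr
    linarith
  have h8 := mul_le_mul_of_nonneg_left h7 (show 0 ≤ C * M ^ 2 by positivity)
  have h9 : (1 + L + B) * M ^ 2 * (κ + 1 / T) * (T * V) = (1 + L + B) * M ^ 2 * q * V := by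
    rw [mul_assoc, hk1]; ring
  rw [h9] at hmono
  have hθ' : 0 < (1 - θ) / 2 := by linarith
  rw [← mul_le_mul_iff_of_pos_left hθ']
  have e : (1 - θ) / 2 * (energyConst L B ℓ θ q * M ^ 2 * V)
      = (1 + L) ^ 2 * M ^ 2 * V
        + C * M ^ 2 * ((q ^ 2 + 3 * (1 + 4 * q ^ 2) * L ^ 2 + 4 * q ^ 2 * B ^ 2) * V)
        + (1 + L + B) * M ^ 2 * q * V := by
    have : (1 - θ) ≠ 0 := by linarith
    rw [energyConst, ← hC]
    field_simp
  rw [e]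
  linarith [e4.2]

end

end LipschitzGraph

namespace LipschitzGraph

noncomputable section

open Set Metric

variable {n : ℕ}

/-! ### Gaussian averages -/

/-- The standard Gaussian density on `ℝⁿ`. -/
def gauss (x : Base n) : ℝ :=
  (∫ y : Base n, Real.exp (-(1 / 2) * ‖y‖ ^ 2))⁻¹ * Real.exp (-(1 / 2) * ‖x‖ ^ 2)

lemma integral_exp_neg_pos {b : ℝ} (hb : 0 < b) :
    0 < ∫ y : Base n, Real.exp (-b * ‖y‖ ^ 2) := by
  rw [GaussianFourier.integral_rexp_neg_mul_sq_norm hb]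
  positivity

lemma integrable_exp_neg {b : ℝ} (hb : 0 < b) :
    Integrable fun y : Base n => Real.exp (-b * ‖y‖ ^ 2) :=
  Integrable.of_integral_ne_zero (integral_exp_neg_pos hb).ne'

lemma gauss_nonneg (x : Base n) : 0 ≤ gauss x :=
  mul_nonneg (inv_nonneg.2 (integral_exp_neg_pos (by norm_num)).le) (Real.exp_pos _).le

lemma integral_gauss : ∫ x : Base n, gauss x = 1 := by
  unfold gauss
  rw [integral_const_mul, inv_mul_cancel₀ (integral_exp_neg_pos (by norm_num)).ne']

@[fun_prop]
lemma continuous_gauss : Continuous (gauss (n := n)) := by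
  unfold gauss; fun_prop

lemma hasFDerivAt_gauss (x : Base n) :
    HasFDerivAt gauss (-(gauss x) • innerSL ℝ x) x := by
  have h := (((hasStrictFDerivAt_norm_sq x).hasFDerivAt.const_mul (-(1 / 2) : ℝ)).exp).const_mul
    (∫ y : Base n, Real.exp (-(1 / 2) * ‖y‖ ^ 2))⁻¹
  refine h.congr_fderiv ?_
  ext y
  simp [gauss]
  ring

/-- All polynomial moments of the Gaussian density are finite. -/
lemma integrable_gauss_mul_pow (k : ℕ) :
    Integrable fun x : Base n => gauss x * (1 + ‖x‖) ^ k := by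
  set Z := (∫ y : Base n, Real.exp (-(1 / 2) * ‖y‖ ^ 2))⁻¹ with hZ
  have hZ0 : 0 ≤ Z := inv_nonneg.2 (integral_exp_neg_pos (by norm_num)).le
  refine Integrable.mono' (((integrable_exp_neg (n := n) (b := 1 / 4) (by norm_num))).const_mul
    (Z * (k.factorial * Real.exp 2))) (by fun_prop) (Filter.Eventually.of_forall fun x => ?_)
  have h0 : 0 ≤ gauss x * (1 + ‖x‖) ^ k := mul_nonneg (gauss_nonneg x) (by positivity)
  rw [Real.norm_of_nonneg h0, gauss, ← hZ]
  have h1 : (1 + ‖x‖) ^ k ≤ k.factorial * Real.exp (1 + ‖x‖) := by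
    have := Real.pow_div_factorial_le_exp (1 + ‖x‖) (by positivity) k
    rwa [div_le_iff₀' (by positivity)] at this
  have h2 : Real.exp (1 + ‖x‖) ≤ Real.exp (2 + 1 / 4 * ‖x‖ ^ 2) := by
    apply Real.exp_le_exp.2
    nlinarith [sq_nonneg (‖x‖ - 2)]
  calc Z * Real.exp (-(1 / 2) * ‖x‖ ^ 2) * (1 + ‖x‖) ^ k
      ≤ Z * Real.exp (-(1 / 2) * ‖x‖ ^ 2) * (k.factorial * Real.exp (2 + 1 / 4 * ‖x‖ ^ 2)) := by
        gcongr
        exact h1.trans (by gcongr)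
    _ = Z * (k.factorial * Real.exp 2) * Real.exp (-(1 / 4) * ‖x‖ ^ 2) := by
        rw [Real.exp_add]
        have : Real.exp (-(1 / 4) * ‖x‖ ^ 2)
            = Real.exp (-(1 / 2) * ‖x‖ ^ 2) * Real.exp (1 / 4 * ‖x‖ ^ 2) := by
          rw [← Real.exp_add]; congr 1; ring
        rw [this]; ring

lemma integrable_gauss : Integrable (gauss (n := n)) := by
  simpa using integrable_gauss_mul_pow (n := n) 0

/-- A function bounded by a polynomial. -/
def PolyBound {F : Type*} [NormedAddCommGroup F] (g : Base n → F) : Prop :=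
  ∃ (k : ℕ) (C : ℝ), ∀ x, ‖g x‖ ≤ C * (1 + ‖x‖) ^ k

lemma PolyBound.nonneg_const {F : Type*} [NormedAddCommGroup F] {g : Base n → F}
    (h : PolyBound g) : ∃ (k : ℕ) (C : ℝ), 0 ≤ C ∧ ∀ x, ‖g x‖ ≤ C * (1 + ‖x‖) ^ k := by
  obtain ⟨k, C, hC⟩ := h
  refine ⟨k, C, ?_, hC⟩
  simpa using (norm_nonneg _).trans (hC 0)

/-- A locally uniform bound for translates and dilates of a polynomially bounded function. -/
lemma PolyBound.comp_affine {F : Type*} [NormedAddCommGroup F] {g : Base n → F}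
    (h : PolyBound g) (R : ℝ) (hR : 0 ≤ R) :
    ∃ (k : ℕ) (C : ℝ), 0 ≤ C ∧ ∀ z t, ‖z‖ ≤ R → |t| ≤ R → ∀ x,
      ‖g (z + t • x)‖ ≤ C * (1 + ‖x‖) ^ k := by
  obtain ⟨k, C, hC0, hC⟩ := h.nonneg_const
  refine ⟨k, C * (1 + R) ^ k, by positivity, fun z t hz ht x => (hC _).trans ?_⟩
  rw [mul_assoc, ← mul_pow]
  gcongr
  calc 1 + ‖z + t • x‖ ≤ 1 + (‖z‖ + |t| * ‖x‖) := by
        gcongr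
        exact (norm_add_le _ _).trans (by rw [norm_smul, Real.norm_eq_abs])
    _ ≤ 1 + (R + R * ‖x‖) := by gcongr
    _ ≤ _ := by nlinarith [norm_nonneg x]

lemma PolyBound.comp {F : Type*} [NormedAddCommGroup F] {g : Base n → F} (h : PolyBound g)
    (z : Base n) (t : ℝ) : PolyBound fun x => g (z + t • x) := by
  obtain ⟨k, C, -, hC⟩ := h.comp_affine (‖z‖ + |t|) (by positivity)
  exact ⟨k, C, hC z t (by linarith [abs_nonneg t]) (by linarith [norm_nonneg z])⟩

/-- Gaussian average of `g` at scale `t` around `z`. As a function of the time `t² / 2` it solves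
the heat equation with initial value `g`. -/
def heat {F : Type*} [NormedAddCommGroup F] [NormedSpace ℝ F] (g : Base n → F) (z : Base n)
    (t : ℝ) : F :=
  ∫ x, gauss x • g (z + t • x)

section

variable {F : Type*} [NormedAddCommGroup F] [NormedSpace ℝ F]

lemma integrable_gauss_smul {g : Base n → F} (hc : Continuous g) (h : PolyBound g) (z : Base n)
    (t : ℝ) : Integrable fun x => gauss x • g (z + t • x) := by
  obtain ⟨k, C, -, hC⟩ := h.comp_affine (‖z‖ + |t|) (by positivity)
  refine Integrable.mono' ((integrable_gauss_mul_pow k).const_mul C) (by fun_prop)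
    (Filter.Eventually.of_forall fun x => ?_)
  rw [norm_smul, Real.norm_of_nonneg (gauss_nonneg x)]
  have := mul_le_mul_of_nonneg_left (hC z t (by linarith [abs_nonneg t])
    (by linarith [norm_nonneg z]) x) (gauss_nonneg x)
  linarith

lemma integrable_gauss_smul_poly {g : Base n → F} (hc : Continuous g) (h : PolyBound g) :
    Integrable fun x => gauss x • g x := by
  simpa using integrable_gauss_smul hc h 0 1

lemma PolyBound.coord_smul {g : Base n → F} (h : PolyBound g) (i : Fin n) :
    PolyBound fun x => x i • g x := by
  obtain ⟨k, C, hC0, hC⟩ := h.nonneg_const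
  refine ⟨k + 1, C, fun x => ?_⟩
  rw [norm_smul, pow_succ, mul_comm, ← mul_assoc]
  have : ‖x i‖ ≤ 1 + ‖x‖ := (PiLp.norm_apply_le x i).trans (by linarith)
  exact mul_le_mul (hC x) this (norm_nonneg _) (by positivity)

lemma PolyBound.clm_apply {g : Base n → Base n →L[ℝ] F} (h : PolyBound g) (e : Base n) :
    PolyBound fun x => g x e := by
  obtain ⟨k, C, hC0, hC⟩ := h.nonneg_const
  refine ⟨k, C * ‖e‖, fun x => ((g x).le_opNorm e).trans ?_⟩
  calc ‖g x‖ * ‖e‖ ≤ C * (1 + ‖x‖) ^ k * ‖e‖ := by gcongr; exact hC x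
    _ = _ := by ring

lemma continuous_heat {g : Base n → F} (hc : Continuous g) (h : PolyBound g) :
    Continuous fun p : Base n × ℝ => heat g p.1 p.2 := by
  rw [continuous_iff_continuousAt]
  intro p
  obtain ⟨k, C, -, hC⟩ := h.comp_affine (‖p.1‖ + |p.2| + 1) (by positivity)
  have hn : ∀ᶠ q : Base n × ℝ in nhds p, ‖q.1‖ < ‖p.1‖ + 1 ∧ |q.2| < |p.2| + 1 := by
    refine Filter.Eventually.and ?_ ?_
    · exact (continuous_fst.norm.tendsto p).eventually_lt_const (by simp)
    · exact ((continuous_abs.comp continuous_snd).tendsto p).eventually_lt_const (by simp)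
  unfold heat
  refine continuousAt_of_dominated (bound := fun x => C * (gauss x * (1 + ‖x‖) ^ k)) ?_ ?_ ?_ ?_
  · exact Filter.Eventually.of_forall fun q => by fun_prop
  · filter_upwards [hn] with q hq
    refine Filter.Eventually.of_forall fun x => ?_
    rw [norm_smul, Real.norm_of_nonneg (gauss_nonneg x)]
    have := mul_le_mul_of_nonneg_left (hC q.1 q.2 (by linarith [abs_nonneg p.2])
      (by linarith [norm_nonneg p.1]) x) (gauss_nonneg x)
    linarith
  · exact (integrable_gauss_mul_pow k).const_mul C
  · exact Filter.Eventually.of_forall fun x => by fun_prop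

lemma heat_zero [CompleteSpace F] (g : Base n → F) (z : Base n) : heat g z 0 = g z := by
  simp [heat, integral_smul_const, integral_gauss]

lemma norm_heat_le {g : Base n → F} {C : ℝ} (h : ∀ x, ‖g x‖ ≤ C) (z : Base n) (t : ℝ) :
    ‖heat g z t‖ ≤ C := by
  have : C = ∫ x : Base n, gauss x * C := by
    rw [integral_mul_const, integral_gauss, one_mul]
  rw [this]
  refine norm_integral_le_of_norm_le (integrable_gauss.mul_const C)
    (Filter.Eventually.of_forall fun x => ?_)
  rw [norm_smul, Real.norm_of_nonneg (gauss_nonneg x)]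
  exact mul_le_mul_of_nonneg_left (h _) (gauss_nonneg x)

lemma integrable_heat_fderiv {g : Base n → F} (hg : ContDiff ℝ 1 g)
    (h' : PolyBound (fderiv ℝ g)) (p : Base n × ℝ) :
    Integrable fun x => gauss x • (fderiv ℝ g (p.1 + p.2 • x)).comp
        (ContinuousLinearMap.fst ℝ (Base n) ℝ
          + (ContinuousLinearMap.snd ℝ (Base n) ℝ).smulRight x) := by
  obtain ⟨k, C, hC0, hC⟩ := h'.comp_affine (‖p.1‖ + |p.2|) (by positivity)
  have hc' := hg.continuous_fderiv one_ne_zero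
  refine Integrable.mono' ((integrable_gauss_mul_pow (k + 1)).const_mul C) ?_
    (Filter.Eventually.of_forall fun x => ?_)
  · refine Continuous.aestronglyMeasurable ?_
    refine continuous_gauss.smul (Continuous.clm_comp (by fun_prop) ?_)
    refine continuous_const.add ?_
    exact ((ContinuousLinearMap.smulRightL ℝ (Base n × ℝ) (Base n))
      (ContinuousLinearMap.snd ℝ (Base n) ℝ)).continuous
  · rw [norm_smul, Real.norm_of_nonneg (gauss_nonneg x)]
    have h1 := hC p.1 p.2 (by linarith [abs_nonneg p.2]) (by linarith [norm_nonneg p.1]) x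
    have h2 : ‖ContinuousLinearMap.fst ℝ (Base n) ℝ
          + (ContinuousLinearMap.snd ℝ (Base n) ℝ).smulRight x‖ ≤ 1 + ‖x‖ := by
      refine (norm_add_le _ _).trans (add_le_add (ContinuousLinearMap.norm_fst_le ..) ?_)
      rw [ContinuousLinearMap.norm_smulRight_apply]
      have := ContinuousLinearMap.norm_snd_le ℝ (Base n) ℝ
      exact mul_le_of_le_one_left (norm_nonneg _) this
    calc _ ≤ gauss x * (C * (1 + ‖x‖) ^ k * (1 + ‖x‖)) := by
          refine mul_le_mul_of_nonneg_left ?_ (gauss_nonneg x)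
          exact (ContinuousLinearMap.opNorm_comp_le _ _).trans
            (mul_le_mul h1 h2 (norm_nonneg _) (by positivity))
      _ = _ := by ring

/-- The joint derivative of the Gaussian average in space and scale. -/
lemma hasFDerivAt_heat {g : Base n → F} (hg : ContDiff ℝ 1 g) (h : PolyBound g)
    (h' : PolyBound (fderiv ℝ g)) (p : Base n × ℝ) :
    HasFDerivAt (fun p : Base n × ℝ => heat g p.1 p.2)
      (∫ x, gauss x • (fderiv ℝ g (p.1 + p.2 • x)).comp
        (ContinuousLinearMap.fst ℝ (Base n) ℝ
          + (ContinuousLinearMap.snd ℝ (Base n) ℝ).smulRight x)) p := by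
  obtain ⟨k, C, hC0, hC⟩ := h'.comp_affine (‖p.1‖ + |p.2| + 1) (by positivity)
  have hn : {q : Base n × ℝ | ‖q.1‖ < ‖p.1‖ + 1 ∧ |q.2| < |p.2| + 1} ∈ nhds p := by
    refine Filter.Eventually.and ?_ ?_
    · exact (continuous_fst.norm.tendsto p).eventually_lt_const (by simp)
    · exact ((continuous_abs.comp continuous_snd).tendsto p).eventually_lt_const (by simp)
  have hc := hg.continuous
  have hc' := hg.continuous_fderiv one_ne_zero
  have hgd : ∀ x, HasFDerivAt g (fderiv ℝ g x) x := fun x =>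
    (hg.differentiable one_ne_zero x).hasFDerivAt
  unfold heat
  refine hasFDerivAt_integral_of_dominated_of_fderiv_le
    (F := fun (q : Base n × ℝ) x => gauss x • g (q.1 + q.2 • x))
    (F' := fun (q : Base n × ℝ) x => gauss x • (fderiv ℝ g (q.1 + q.2 • x)).comp
        (ContinuousLinearMap.fst ℝ (Base n) ℝ
          + (ContinuousLinearMap.snd ℝ (Base n) ℝ).smulRight x))
    (bound := fun x => C * (gauss x * (1 + ‖x‖) ^ (k + 1)))
    hn ?_ ?_ ?_ ?_ ?_ ?_
  · exact Filter.Eventually.of_forall fun q => by fun_prop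
  · exact integrable_gauss_smul hc h p.1 p.2
  · exact (integrable_heat_fderiv hg h' p).1
  · refine Filter.Eventually.of_forall fun x q hq => ?_
    rw [norm_smul, Real.norm_of_nonneg (gauss_nonneg x)]
    have h1 := hC q.1 q.2 (by linarith [abs_nonneg p.2, hq.1])
      (by linarith [norm_nonneg p.1, hq.2]) x
    have h2 : ‖ContinuousLinearMap.fst ℝ (Base n) ℝ
          + (ContinuousLinearMap.snd ℝ (Base n) ℝ).smulRight x‖ ≤ 1 + ‖x‖ := by
      refine (norm_add_le _ _).trans (add_le_add (ContinuousLinearMap.norm_fst_le ..) ?_)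
      rw [ContinuousLinearMap.norm_smulRight_apply]
      have := ContinuousLinearMap.norm_snd_le ℝ (Base n) ℝ
      exact mul_le_of_le_one_left (norm_nonneg _) this
    calc _ ≤ gauss x * (C * (1 + ‖x‖) ^ k * (1 + ‖x‖)) := by
          refine mul_le_mul_of_nonneg_left ?_ (gauss_nonneg x)
          exact (ContinuousLinearMap.opNorm_comp_le _ _).trans
            (mul_le_mul h1 h2 (norm_nonneg _) (by positivity))
      _ = _ := by ring
  · exact (integrable_gauss_mul_pow (k + 1)).const_mul C
  · refine Filter.Eventually.of_forall fun x q _ => ?_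
    have h1 : HasFDerivAt (fun q : Base n × ℝ => q.1 + q.2 • x)
        (ContinuousLinearMap.fst ℝ (Base n) ℝ
          + (ContinuousLinearMap.snd ℝ (Base n) ℝ).smulRight x) q :=
      hasFDerivAt_fst.add (hasFDerivAt_snd.smul_const x)
    exact ((hgd _).comp q h1).const_smul (gauss x)

lemma hasFDerivAt_heat_space {g : Base n → F} (hg : ContDiff ℝ 1 g) (h : PolyBound g)
    (h' : PolyBound (fderiv ℝ g)) (z : Base n) (t : ℝ) :
    HasFDerivAt (heat g · t) (heat (fderiv ℝ g) z t) z := by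
  have h1 := HasFDerivAt.comp (f := fun e : Base n => (e, t)) z (hasFDerivAt_heat hg h h' (z, t))
    (hasFDerivAt_prodMk_left z t)
  refine h1.congr_fderiv ?_
  ext y
  have hi := integrable_heat_fderiv hg h' (z, t)
  have hi2 := integrable_gauss_smul (hg.continuous_fderiv one_ne_zero) h' z t
  rw [ContinuousLinearMap.comp_apply, ContinuousLinearMap.integral_apply hi, heat,
    ContinuousLinearMap.integral_apply hi2]
  simp

lemma hasDerivAt_heat_aux {g : Base n → F} (hg : ContDiff ℝ 1 g) (h : PolyBound g)
    (h' : PolyBound (fderiv ℝ g)) (z : Base n) (t : ℝ) :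
    HasDerivAt (heat g z) (∫ x, gauss x • fderiv ℝ g (z + t • x) x) t := by
  have h1 := (HasFDerivAt.comp (f := fun e : ℝ => (z, e)) t (hasFDerivAt_heat hg h h' (z, t))
    (hasFDerivAt_prodMk_right z t)).hasDerivAt
  refine h1.congr_deriv ?_
  have hi := integrable_heat_fderiv hg h' (z, t)
  rw [ContinuousLinearMap.comp_apply, ContinuousLinearMap.integral_apply hi]
  simp

/-- Gaussian integration by parts, based on `∇(gauss x) = -(gauss x) x`. -/
lemma integral_gauss_ibp {A : Base n → F} (hA : ContDiff ℝ 1 A) (h : PolyBound A)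
    (h' : PolyBound (fderiv ℝ A)) (z : Base n) (t : ℝ) (i : Fin n) :
    ∫ x : Base n, gauss x • x i • A (z + t • x)
      = t • ∫ x, gauss x • fderiv ℝ A (z + t • x) (EuclideanSpace.single i 1) := by
  have hAd : ∀ x, HasFDerivAt (fun x => A (z + t • x)) (t • fderiv ℝ A (z + t • x)) x := by
    intro x
    have h1 : HasFDerivAt (fun x : Base n => z + t • x)
        (t • ContinuousLinearMap.id ℝ (Base n)) x :=
      ((hasFDerivAt_id x).const_smul t).const_add z
    refine (((hA.differentiable one_ne_zero _).hasFDerivAt).comp x h1).congr_fderiv ?_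
    ext y
    simp
  have hcA := hA.continuous
  have hcA' := hA.continuous_fderiv one_ne_zero
  have key := integral_bilinear_hasFDerivAt_right_eq_neg_left_of_integrable (μ := volume)
    (f := gauss (n := n)) (f' := fun x => -(gauss x) • innerSL ℝ x)
    (g := fun x => A (z + t • x)) (g' := fun x => t • fderiv ℝ A (z + t • x))
    (v := EuclideanSpace.single i 1) (B := ContinuousLinearMap.lsmul ℝ ℝ)
    ?_ ?_ ?_ (fun x _ => hasFDerivAt_gauss x) (fun x _ => hAd x)
  · have e1 : ∀ x : Base n, gauss x • x i • A (z + t • x)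
        = -((ContinuousLinearMap.lsmul ℝ ℝ)
          ((-(gauss x) • innerSL ℝ x) (EuclideanSpace.single i 1))) (A (z + t • x)) := by
      intro x
      simp [EuclideanSpace.inner_single_right, smul_smul]
    simp_rw [e1]
    rw [integral_neg, ← key]
    simp only [ContinuousLinearMap.lsmul_apply, smul_apply]
    rw [← integral_smul]
    exact integral_congr_ae (Filter.Eventually.of_forall fun x => smul_comm _ _ _)
  · refine ((integrable_gauss_smul_poly (by fun_prop)
      ((h.comp z t).coord_smul i)).neg).congr (Filter.Eventually.of_forall fun x => ?_)
    simp [EuclideanSpace.inner_single_right, smul_smul]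
  · refine ((integrable_gauss_smul (by fun_prop) (h'.clm_apply (EuclideanSpace.single i 1)) z
      t).smul t).congr (Filter.Eventually.of_forall fun x => ?_)
    simp [smul_smul]
  · exact integrable_gauss_smul hcA h z t

end

end

end LipschitzGraph

namespace LipschitzGraph

noncomputable section

open Set Metric Function
open scoped ContDiff

variable {n : ℕ}

/-! ### The caloric extension of a smooth Lipschitz function -/

section

variable {F : Type*} [NormedAddCommGroup F] [NormedSpace ℝ F]

lemma polyBound_of_temperate {g : Base n → F} (hg : HasTemperateGrowth g) : PolyBound g := by
  obtain ⟨k, C, h⟩ := hg.2 0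
  exact ⟨k, C, fun x => by simpa using h x⟩

lemma temperate_fderiv {g : Base n → F} (hg : HasTemperateGrowth g) :
    HasTemperateGrowth (fderiv ℝ g) := by
  refine ⟨hg.1.fderiv_right (by simp), fun k => ?_⟩
  obtain ⟨m, C, h⟩ := hg.2 (k + 1)
  exact ⟨m, C, fun x => by rw [norm_iteratedFDeriv_fderiv]; exact h x⟩

lemma temperate_clm_comp {F' : Type*} [NormedAddCommGroup F'] [NormedSpace ℝ F'] {g : Base n → F}
    (hg : HasTemperateGrowth g) (l : F →L[ℝ] F') : HasTemperateGrowth fun x => l (g x) :=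
  HasTemperateGrowth.comp l.hasTemperateGrowth hg

/-- The `i`-th partial derivative. -/
def pd (i : Fin n) (g : Base n → F) (x : Base n) : F :=
  fderiv ℝ g x (EuclideanSpace.single i 1)

lemma temperate_pd {g : Base n → F} (hg : HasTemperateGrowth g) (i : Fin n) :
    HasTemperateGrowth (pd i g) :=
  temperate_clm_comp (temperate_fderiv hg)
    (ContinuousLinearMap.apply ℝ F (EuclideanSpace.single i (1 : ℝ)))

lemma pd_comm {g : Base n → F} (hg : ContDiff ℝ ∞ g) (i j : Fin n) :
    pd i (pd j g) = pd j (pd i g) := by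
  have hd : Differentiable ℝ (fderiv ℝ g) :=
    (hg.fderiv_right (m := ∞) (by simp)).differentiable (by simp)
  have e : ∀ (i j : Fin n) x, pd i (pd j g) x
      = fderiv ℝ (fderiv ℝ g) x (EuclideanSpace.single i 1) (EuclideanSpace.single j 1) := by
    intro i j x
    unfold pd
    rw [fderiv_clm_apply (hd x) (differentiableAt_const _)]
    simp
  ext x
  rw [e, e]
  exact (contDiff_infty.1 hg 2).contDiffAt.isSymmSndFDerivAt (by simp) _ _

/-- The Laplacian, as the sum of the pure second partial derivatives. -/
def lapl (g : Base n → F) (x : Base n) : F :=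
  ∑ i, pd i (pd i g) x

lemma temperate_lapl {g : Base n → F} (hg : HasTemperateGrowth g) :
    HasTemperateGrowth (lapl g) := by
  have : lapl g = fun x => ∑ i, pd i (pd i g) x := rfl
  rw [this]
  exact HasTemperateGrowth.sum fun i _ => temperate_pd (temperate_pd hg i) i

lemma sum_smul_single (x : Base n) : ∑ i, x i • EuclideanSpace.single i (1 : ℝ) = x := by
  simpa using (EuclideanSpace.basisFun (Fin n) ℝ).sum_repr x

/-- The integral on the left is `∂ₜ` of the Gaussian average; integrating by parts against the
Gaussian density exhibits it as `t Δ`. -/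
lemma integral_fderiv_gauss {g : Base n → F} (hg : HasTemperateGrowth g) (z : Base n) (t : ℝ) :
    ∫ x, gauss x • fderiv ℝ g (z + t • x) x = t • heat (lapl g) z t := by
  have hpd := fun i => temperate_pd hg i
  have e : ∀ x : Base n, gauss x • fderiv ℝ g (z + t • x) x
      = ∑ i, gauss x • x i • pd i g (z + t • x) := by
    intro x
    rw [← Finset.smul_sum]
    congr 1
    conv_lhs => rw [← sum_smul_single x]
    simp only [map_sum, map_smul]
    rw [sum_smul_single]
    rfl
  have hi : ∀ i : Fin n, Integrable fun x => gauss x • x i • pd i g (z + t • x) := by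
    intro i
    have hc : Continuous (pd i g) := (hpd i).1.continuous
    exact integrable_gauss_smul_poly (by fun_prop)
      (((polyBound_of_temperate (hpd i)).comp z t).coord_smul i)
  simp_rw [e]
  rw [integral_finsetSum _ fun i _ => hi i]
  simp_rw [integral_gauss_ibp ((hpd _).1.of_le (by simp)) (polyBound_of_temperate (hpd _))
    (polyBound_of_temperate (temperate_fderiv (hpd _)))]
  rw [← Finset.smul_sum]
  congr 1
  unfold heat lapl
  simp_rw [Finset.smul_sum]
  rw [integral_finsetSum]
  · rfl
  · intro i _
    exact integrable_gauss_smul (temperate_pd (hpd i) i).1.continuous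
      (polyBound_of_temperate (temperate_pd (hpd i) i)) z t

/-- The heat equation `∂ₜ = t Δ` in the scale variable. -/
lemma hasDerivAt_heat {g : Base n → F} (hg : HasTemperateGrowth g) (z : Base n) (t : ℝ) :
    HasDerivAt (heat g z) (t • heat (lapl g) z t) t := by
  rw [← integral_fderiv_gauss hg]
  exact hasDerivAt_heat_aux (hg.1.of_le (by simp)) (polyBound_of_temperate hg)
    (polyBound_of_temperate (temperate_fderiv hg)) z t

lemma heat_clm_comp [CompleteSpace F] {F' : Type*} [NormedAddCommGroup F'] [NormedSpace ℝ F']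
    [CompleteSpace F'] {g : Base n → F} (hg : HasTemperateGrowth g) (l : F →L[ℝ] F') (z : Base n)
    (t : ℝ) : heat (fun x => l (g x)) z t = l (heat g z t) := by
  unfold heat
  rw [← l.integral_comp_comm
    (integrable_gauss_smul hg.1.continuous (polyBound_of_temperate hg) z t)]
  simp

end

/-- The vector representing a linear functional. -/
def vecOf : (Base n →L[ℝ] ℝ) →L[ℝ] Base n :=
  ∑ i, (ContinuousLinearMap.apply ℝ ℝ (EuclideanSpace.single i (1 : ℝ))).smulRight
    (EuclideanSpace.single i (1 : ℝ))

lemma vecOf_apply (l : Base n →L[ℝ] ℝ) (i : Fin n) :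
    vecOf l i = l (EuclideanSpace.single i 1) := by
  simp [vecOf, Finset.sum_apply, Pi.single_apply]

lemma innerSL_vecOf (l : Base n →L[ℝ] ℝ) : innerSL ℝ (vecOf l) = l := by
  ext y
  rw [← sum_apply_single_mul l y]
  simp [PiLp.inner_apply, vecOf_apply, mul_comm]

lemma norm_vecOf (l : Base n →L[ℝ] ℝ) : ‖vecOf l‖ = ‖l‖ := by
  conv_rhs => rw [← innerSL_vecOf l]
  simp

/-- The gradient vector field of `g`. -/
def grad (g : Base n → ℝ) (x : Base n) : Base n := vecOf (fderiv ℝ g x)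

lemma temperate_grad {g : Base n → ℝ} (hg : HasTemperateGrowth g) : HasTemperateGrowth (grad g) :=
  temperate_clm_comp (temperate_fderiv hg) vecOf

lemma hasGradientAt_heat {g : Base n → ℝ} (hg : HasTemperateGrowth g) (z : Base n) (t : ℝ) :
    HasGradientAt (heat g · t) (heat (grad g) z t) z := by
  rw [hasGradientAt_iff_hasFDerivAt]
  refine (hasFDerivAt_heat_space (hg.1.of_le (by simp)) (polyBound_of_temperate hg)
    (polyBound_of_temperate (temperate_fderiv hg)) z t).congr_fderiv ?_
  have h1 : heat (grad g) z t = vecOf (heat (fderiv ℝ g) z t) :=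
    heat_clm_comp (temperate_fderiv hg) vecOf z t
  rw [h1]
  conv_lhs => rw [← innerSL_vecOf (heat (fderiv ℝ g) z t)]
  rfl

/-- The trace as a continuous linear map. -/
def trL : (Base n →L[ℝ] Base n) →L[ℝ] ℝ :=
  ∑ i, (EuclideanSpace.proj i : Base n →L[ℝ] ℝ).comp
    (ContinuousLinearMap.apply ℝ (Base n) (EuclideanSpace.single i (1 : ℝ)))

lemma trL_apply (A : Base n →L[ℝ] Base n) : trL A = tr A := by
  simp [trL, tr]

lemma fderiv_coord {g : Base n → Base n} {x : Base n} (hg : DifferentiableAt ℝ g x) (i : Fin n)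
    (y : Base n) : fderiv ℝ g x y i = fderiv ℝ (fun x => g x i) x y := by
  have h := ((EuclideanSpace.proj i : Base n →L[ℝ] ℝ).hasFDerivAt.comp x hg.hasFDerivAt)
  have h2 : fderiv ℝ (fun x => g x i) x
      = (EuclideanSpace.proj i : Base n →L[ℝ] ℝ).comp (fderiv ℝ g x) := h.fderiv
  rw [h2]
  rfl

lemma tr_fderiv_grad {g : Base n → ℝ} (hg : HasTemperateGrowth g) (x : Base n) :
    tr (fderiv ℝ (grad g) x) = lapl g x := by
  unfold tr lapl
  refine Finset.sum_congr rfl fun i _ => ?_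
  rw [fderiv_coord ((temperate_grad hg).1.differentiable (by simp) x)]
  simp only [grad, vecOf_apply]
  rfl

lemma lapl_grad {g : Base n → ℝ} (hg : HasTemperateGrowth g) :
    lapl (grad g) = grad (lapl g) := by
  ext x i
  have hsm : ∀ j, Differentiable ℝ (pd j (pd j g)) := fun j =>
    (temperate_pd (temperate_pd hg j) j).1.differentiable (by simp)
  have h1 : grad (lapl g) x i = ∑ j, pd i (pd j (pd j g)) x := by
    simp only [grad, vecOf_apply]
    have : lapl g = fun x => ∑ j, pd j (pd j g) x := rfl
    rw [this, fderiv_fun_sum fun j _ => hsm j x]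
    simp [pd]
  have h2 : ∀ j, (pd j (pd j (grad g)) x) i = pd j (pd j (pd i g)) x := by
    intro j
    have e1 : ∀ y, (pd j (grad g) y) i = pd j (pd i g) y := by
      intro y
      unfold pd
      rw [fderiv_coord ((temperate_grad hg).1.differentiable (by simp) y)]
      simp only [grad, vecOf_apply]
    have e2 : (pd j (pd j (grad g)) x) i
        = fderiv ℝ (fun y => (pd j (grad g) y) i) x (EuclideanSpace.single j 1) :=
      fderiv_coord ((temperate_pd (temperate_grad hg) j).1.differentiable (by simp) x) i _
    rw [e2]
    simp_rw [e1]
    rfl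
  rw [h1]
  simp only [lapl, WithLp.ofLp_sum, Finset.sum_apply, h2]
  refine Finset.sum_congr rfl fun j _ => ?_
  rw [pd_comm hg.1 j i, pd_comm (temperate_pd hg j).1 j i]

/-- The first absolute moment of the Gaussian density. -/
def gaussMoment (n : ℕ) : ℝ := ∫ x : Base n, gauss x * ‖x‖

lemma integrable_gauss_mul_norm : Integrable fun x : Base n => gauss x * ‖x‖ := by
  refine Integrable.mono' (integrable_gauss_mul_pow (n := n) 1) (by fun_prop)
    (Filter.Eventually.of_forall fun x => ?_)
  rw [Real.norm_of_nonneg (mul_nonneg (gauss_nonneg x) (norm_nonneg x))]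
  exact mul_le_mul_of_nonneg_left (by simp) (gauss_nonneg x)

/-- The caloric extension of a smooth function with gradient bounded by `L`. The bound for `|t ΔP|`
depends only on `L` because `t ΔP` is an average of first derivatives, by
`integral_fderiv_gauss`. -/
def caloricExtension {L : ℝ} (ψ : Base n → ℝ) (hψ : HasTemperateGrowth ψ)
    (hL : ∀ x, ‖fderiv ℝ ψ x‖ ≤ L) : CaloricExtension n L (L * gaussMoment n) where
  P := heat ψ
  G := heat (grad ψ)
  D := heat (lapl ψ)
  H := heat (grad (lapl ψ))
  K := heat (lapl (lapl ψ))
  G' := heat (fderiv ℝ (grad ψ))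
  H' := heat (fderiv ℝ (grad (lapl ψ)))
  continuous_P := continuous_heat hψ.1.continuous (polyBound_of_temperate hψ)
  continuous_G := continuous_heat (temperate_grad hψ).1.continuous
    (polyBound_of_temperate (temperate_grad hψ))
  continuous_D := continuous_heat (temperate_lapl hψ).1.continuous
    (polyBound_of_temperate (temperate_lapl hψ))
  continuous_H := continuous_heat (temperate_grad (temperate_lapl hψ)).1.continuous
    (polyBound_of_temperate (temperate_grad (temperate_lapl hψ)))
  continuous_G' := continuous_heat (temperate_fderiv (temperate_grad hψ)).1.continuous
    (polyBound_of_temperate (temperate_fderiv (temperate_grad hψ)))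
  continuous_H' := continuous_heat
    (temperate_fderiv (temperate_grad (temperate_lapl hψ))).1.continuous
    (polyBound_of_temperate (temperate_fderiv (temperate_grad (temperate_lapl hψ))))
  grad_P := hasGradientAt_heat hψ
  grad_D := hasGradientAt_heat (temperate_lapl hψ)
  fderiv_G := hasFDerivAt_heat_space ((temperate_grad hψ).1.of_le (by simp))
    (polyBound_of_temperate (temperate_grad hψ))
    (polyBound_of_temperate (temperate_fderiv (temperate_grad hψ)))
  fderiv_H := hasFDerivAt_heat_space ((temperate_grad (temperate_lapl hψ)).1.of_le (by simp))
    (polyBound_of_temperate (temperate_grad (temperate_lapl hψ)))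
    (polyBound_of_temperate (temperate_fderiv (temperate_grad (temperate_lapl hψ))))
  tr_G' z t := by
    rw [← trL_apply, ← heat_clm_comp (temperate_fderiv (temperate_grad hψ))]
    simp_rw [trL_apply, tr_fderiv_grad hψ]
  tr_H' z t := by
    rw [← trL_apply, ← heat_clm_comp (temperate_fderiv (temperate_grad (temperate_lapl hψ)))]
    simp_rw [trL_apply, tr_fderiv_grad (temperate_lapl hψ)]
  deriv_P := hasDerivAt_heat hψ
  deriv_G z t := by
    rw [← lapl_grad hψ]
    exact hasDerivAt_heat (temperate_grad hψ) z t
  deriv_D := hasDerivAt_heat (temperate_lapl hψ)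
  norm_G := norm_heat_le fun x => by rw [grad, norm_vecOf]; exact hL x
  abs_D z t := by
    rw [← smul_eq_mul, ← integral_fderiv_gauss hψ, ← Real.norm_eq_abs, gaussMoment,
      ← integral_const_mul]
    refine norm_integral_le_of_norm_le (integrable_gauss_mul_norm.const_mul L)
      (Filter.Eventually.of_forall fun x => ?_)
    rw [norm_smul, Real.norm_of_nonneg (gauss_nonneg x)]
    have := mul_le_mul_of_nonneg_left (((fderiv ℝ ψ (z + t • x)).le_opNorm x).trans
      (mul_le_mul_of_nonneg_right (hL _) (norm_nonneg x))) (gauss_nonneg x)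
    linarith

end

end LipschitzGraph

namespace LipschitzGraph

noncomputable section

open Set Metric Function
open scoped ContDiff

variable {n : ℕ}

/-! ### Flattening the domain -/

instance : ContinuousSMul ℝ (Ambient n) := IsBoundedSMul.continuousSMul

/-- The inclusion `z ↦ (z, 0)`. -/
def incZ (n : ℕ) : Base n →L[ℝ] Ambient n :=
  ((WithLp.prodContinuousLinearEquiv 2 ℝ (Base n) ℝ).symm : Base n × ℝ →L[ℝ] Ambient n).comp
    (ContinuousLinearMap.inl ℝ (Base n) ℝ)

/-- The vertical unit vector `(0, 1)`. -/
def vert (n : ℕ) : Ambient n := WithLp.toLp 2 (0, 1)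

lemma incZ_apply (z : Base n) : incZ n z = WithLp.toLp 2 (z, 0) := rfl

lemma incZ_add_vert (z : Base n) (y : ℝ) : incZ n z + y • vert n = WithLp.toLp 2 (z, y) := by
  rw [incZ_apply, vert, ← WithLp.toLp_smul, ← WithLp.toLp_add]
  simp

/-- The horizontal part of a linear functional on `ℝⁿ × ℝ`, as a vector. -/
def horiz (n : ℕ) : (Ambient n →L[ℝ] ℝ) →L[ℝ] Base n :=
  vecOf.comp ((ContinuousLinearMap.compL ℝ (Base n) (Ambient n) ℝ).flip (incZ n))

lemma horiz_apply (l : Ambient n →L[ℝ] ℝ) (i : Fin n) :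
    horiz n l i = l (incZ n (EuclideanSpace.single i 1)) := by
  simp [horiz, vecOf_apply]

lemma inner_horiz (l : Ambient n →L[ℝ] ℝ) (z : Base n) :
    inner ℝ (horiz n l) z = l (incZ n z) := by
  have := DFunLike.congr_fun (innerSL_vecOf (l.comp (incZ n))) z
  simpa [horiz] using this

/-- The splitting of `|∇u|²` into its horizontal and vertical parts. -/
lemma norm_gradient_sq (u : Ambient n → ℝ) (p : Ambient n) :
    ‖gradient u p‖ ^ 2 = ‖horiz n (fderiv ℝ u p)‖ ^ 2 + (fderiv ℝ u p (vert n)) ^ 2 := by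
  have hg : ∀ q, fderiv ℝ u p q = inner ℝ (gradient u p) q := fun q => by
    simp [gradient]
  have h1 : horiz n (fderiv ℝ u p) = (gradient u p).fst := by
    ext i
    rw [horiz_apply, hg, incZ_apply, WithLp.prod_inner_apply]
    simp [EuclideanSpace.inner_single_right]
  have h2 : fderiv ℝ u p (vert n) = (gradient u p).snd := by
    rw [hg, vert, WithLp.prod_inner_apply]
    simp
  rw [WithLp.prod_norm_sq_eq_of_L2, h1, h2, Real.norm_eq_abs, sq_abs]

/-- The splitting of the Laplacian into its horizontal and vertical parts. -/
lemma laplacian_eq (u : Ambient n → ℝ) (p : Ambient n) :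
    Laplacian.laplacian u p
      = ∑ i, fderiv ℝ (fderiv ℝ u) p (incZ n (EuclideanSpace.single i 1))
          (incZ n (EuclideanSpace.single i 1))
        + fderiv ℝ (fderiv ℝ u) p (vert n) (vert n) := by
  rw [InnerProductSpace.laplacian_eq_iteratedFDeriv_orthonormalBasis u
    ((EuclideanSpace.basisFun (Fin n) ℝ).prod (OrthonormalBasis.singleton Unit ℝ))]
  simp [iteratedFDeriv_two_apply, incZ_apply, vert]

lemma isOpen_domain {φ : Base n → ℝ} (hφ : Continuous φ) : IsOpen (domain φ) := by
  unfold domain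
  exact isOpen_lt (hφ.comp (WithLp.fstL 2 ℝ (Base n) ℝ).continuous)
    (WithLp.sndL 2 ℝ (Base n) ℝ).continuous

section

variable {L B ℓ θ M : ℝ}

/-- The flattening map `(z, t) ↦ (z, P(z, t) + ℓ t)`, extended constantly to negative `t`.
The extension takes values in the domain, so that compositions with `u` and its derivatives are
continuous on the whole space. -/
def flatMap (F : CaloricExtension n L B) (ℓ : ℝ) (z : Base n) (t : ℝ) : Ambient n :=
  incZ n z + (F.P z (max t 0) + ℓ * max t 0) • vert n

lemma continuous_flatMap (F : CaloricExtension n L B) (ℓ : ℝ) :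
    Continuous fun p : Base n × ℝ => flatMap F ℓ p.1 p.2 := by
  unfold flatMap
  have h : Continuous fun p : Base n × ℝ => F.P p.1 (max p.2 0) :=
    F.continuous_P.comp (f := fun p : Base n × ℝ => (p.1, max p.2 0)) (by fun_prop)
  fun_prop

lemma hasDerivAt_height (F : CaloricExtension n L B) (ℓ : ℝ) (z : Base n) (t : ℝ) :
    HasDerivAt (fun t => F.P z t + ℓ * t) (ℓ + t * F.D z t) t :=
  ((F.deriv_P z t).add ((hasDerivAt_id t).const_mul ℓ)).congr_deriv (by ring)

lemma one_le_jacobian (F : CaloricExtension n L B) (hℓ : 1 + B ≤ ℓ) (z : Base n) (t : ℝ) :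
    1 ≤ ℓ + t * F.D z t := by
  have := (abs_le.1 (F.abs_D z t)).1
  linarith

lemma monotone_height (F : CaloricExtension n L B) (hℓ : 1 + B ≤ ℓ) (z : Base n) :
    Monotone fun t => F.P z t + ℓ * t :=
  monotone_of_hasDerivAt_nonneg (hasDerivAt_height F ℓ z)
    (fun t => by have := one_le_jacobian F hℓ z t; simp only [Pi.zero_apply]; linarith)

lemma flatMap_mem_domain (F : CaloricExtension n L B) (hℓ : 1 + B ≤ ℓ) {φ : Base n → ℝ}
    (hP : ∀ z, φ z < F.P z 0) (z : Base n) (t : ℝ) : flatMap F ℓ z t ∈ domain φ := by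
  rw [flatMap, incZ_add_vert]
  have h := monotone_height F hℓ z (le_max_right t 0)
  simp only [mul_zero, add_zero] at h
  exact (hP z).trans_le h

lemma hasFDerivAt_flatMap_space (F : CaloricExtension n L B) (ℓ : ℝ) (z : Base n) {t : ℝ}
    (ht : 0 < t) : HasFDerivAt (flatMap F ℓ · t)
      (incZ n + (innerSL ℝ (F.G z t)).smulRight (vert n)) z := by
  unfold flatMap
  rw [max_eq_left ht.le]
  have h : HasFDerivAt (fun z => F.P z t + ℓ * t) (innerSL ℝ (F.G z t)) z :=
    (F.grad_P z t).hasFDerivAt.add_const (ℓ * t)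
  exact (incZ n).hasFDerivAt.add (h.smul_const (vert n))

lemma hasDerivAt_flatMap_time (F : CaloricExtension n L B) (ℓ : ℝ) (z : Base n) {t : ℝ}
    (ht : 0 < t) : HasDerivAt (flatMap F ℓ z) ((ℓ + t * F.D z t) • vert n) t := by
  have h := ((hasDerivAt_height F ℓ z t).smul_const (vert n)).const_add (incZ n z)
  refine h.congr_of_eventuallyEq ?_
  filter_upwards [lt_mem_nhds ht] with s hs
  simp only [flatMap, max_eq_left hs.le]

/-- A bounded function with `|u Δu| ≤ θ |∇u|²`, read in the flattened coordinates. -/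
def flatSolution (F : CaloricExtension n L B) (hℓ : 1 + B ≤ ℓ) {φ : Base n → ℝ}
    (hφ : Continuous φ) (hP : ∀ z, φ z < F.P z 0) {u : Ambient n → ℝ}
    (hu : ContDiffOn ℝ 2 u (domain φ)) (hs : SharpCondition φ θ u)
    (hM : ∀ p ∈ domain φ, |u p| ≤ M) (T : ℝ) : FlatSolution F ℓ θ M T :=
  have ho := isOpen_domain hφ
  have hmem := flatMap_mem_domain F hℓ hP
  have hu1 : ContDiffOn ℝ 1 (fderiv ℝ u) (domain φ) := hu.fderiv_of_isOpen ho (by norm_num)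
  have hu2 : ContinuousOn (fderiv ℝ (fderiv ℝ u)) (domain φ) :=
    hu1.continuousOn_fderiv_of_isOpen ho (by norm_num)
  have hX := continuous_flatMap F ℓ
  have c0 : Continuous fun p : Base n × ℝ => u (flatMap F ℓ p.1 p.2) :=
    hu.continuousOn.comp_continuous hX fun p => hmem p.1 p.2
  have c1 : Continuous fun p : Base n × ℝ => fderiv ℝ u (flatMap F ℓ p.1 p.2) :=
    hu1.continuousOn.comp_continuous hX fun p => hmem p.1 p.2
  have c2 : Continuous fun p : Base n × ℝ => fderiv ℝ (fderiv ℝ u) (flatMap F ℓ p.1 p.2) :=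
    hu2.comp_continuous hX fun p => hmem p.1 p.2
  have d1 : ∀ z t, HasFDerivAt u (fderiv ℝ u (flatMap F ℓ z t)) (flatMap F ℓ z t) := fun z t =>
    ((hu.contDiffAt (ho.mem_nhds (hmem z t))).differentiableAt (by norm_num)).hasFDerivAt
  have d2 : ∀ z t, HasFDerivAt (fderiv ℝ u) (fderiv ℝ (fderiv ℝ u) (flatMap F ℓ z t))
      (flatMap F ℓ z t) := fun z t =>
    ((hu1.contDiffAt (ho.mem_nhds (hmem z t))).differentiableAt (by norm_num)).hasFDerivAt
  { v := fun z t => u (flatMap F ℓ z t)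
    U := fun z t => horiz n (fderiv ℝ u (flatMap F ℓ z t))
    Uy := fun z t => fderiv ℝ u (flatMap F ℓ z t) (vert n)
    Y := fun z t => horiz n (fderiv ℝ (fderiv ℝ u) (flatMap F ℓ z t) (vert n))
    Ly := fun z t => fderiv ℝ (fderiv ℝ u) (flatMap F ℓ z t) (vert n) (vert n)
    Lz := fun z t => ∑ i, fderiv ℝ (fderiv ℝ u) (flatMap F ℓ z t)
      (incZ n (EuclideanSpace.single i 1)) (incZ n (EuclideanSpace.single i 1))
    U' := fun z t => (horiz n).comp ((fderiv ℝ (fderiv ℝ u) (flatMap F ℓ z t)).comp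
      (incZ n + (innerSL ℝ (F.G z t)).smulRight (vert n)))
    continuous_v := c0
    continuous_U := by fun_prop
    continuous_Uy := by fun_prop
    continuous_Y := by fun_prop
    continuous_Ly := by fun_prop
    continuous_U' := by
      have c3 : Continuous fun p : Base n × ℝ => (innerSL ℝ (F.G p.1 p.2)).smulRight (vert n) :=
        ((ContinuousLinearMap.smulRightL ℝ (Base n) (Ambient n)).flip (vert n)).continuous.comp
          ((innerSL ℝ).continuous.comp F.continuous_G)
      exact continuous_const.clm_comp (c2.clm_comp (continuous_const.add c3))
    grad_v := fun z t ht => by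
      rw [hasGradientAt_iff_hasFDerivAt]
      refine ((d1 z t).comp z (hasFDerivAt_flatMap_space F ℓ z ht.1)).congr_fderiv ?_
      ext y
      simp [inner_horiz, mul_comm]
    deriv_v := fun z t ht => by
      refine ((d1 z t).comp_hasDerivAt t (hasDerivAt_flatMap_time F ℓ z ht.1)).congr_deriv ?_
      simp
    fderiv_U := fun z t ht =>
      (horiz n).hasFDerivAt.comp z ((d2 z t).comp z (hasFDerivAt_flatMap_space F ℓ z ht.1))
    tr_U' := fun z t => by
      simp only [tr, ContinuousLinearMap.comp_apply, horiz_apply, PiLp.inner_apply]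
      rw [← Finset.sum_add_distrib]
      refine Finset.sum_congr rfl fun i _ => ?_
      simp [EuclideanSpace.inner_single_right, mul_comm]
    deriv_U := fun z t ht => by
      refine ((horiz n).hasFDerivAt.comp_hasDerivAt t
        ((d2 z t).comp_hasDerivAt t (hasDerivAt_flatMap_time F ℓ z ht.1))).congr_deriv ?_
      simp
    deriv_Uy := fun z t ht => by
      have h := ((ContinuousLinearMap.apply ℝ ℝ (vert n)).hasFDerivAt.comp_hasDerivAt t
        ((d2 z t).comp_hasDerivAt t (hasDerivAt_flatMap_time F ℓ z ht.1)))
      exact h.congr_deriv (by simp)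
    abs_v := fun z t => hM _ (hmem z t)
    sharp := fun z t => by
      have h := hs _ (hmem z t)
      rwa [laplacian_eq, norm_gradient_sq] at h }

end

end

end LipschitzGraph

namespace LipschitzGraph

noncomputable section

open Set Metric Function
open scoped ContDiff Convolution

variable {n : ℕ}

/-! ### Smooth approximation of the graph -/

lemma LipschitzWith.polyBound {L : ℝ≥0} {φ : Base n → ℝ} (hφ : LipschitzWith L φ) :
    PolyBound φ := by
  refine ⟨1, |φ 0| + L, fun x => ?_⟩
  have h := hφ.dist_le_mul x 0
  rw [dist_zero_right, Real.dist_eq] at h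
  have h2 : |φ x| ≤ |φ 0| + |φ x - φ 0| := by
    have := abs_add_le (φ 0) (φ x - φ 0)
    simpa using this
  rw [Real.norm_eq_abs, pow_one]
  nlinarith [mul_nonneg (abs_nonneg (φ 0)) (norm_nonneg x), L.2, NNReal.coe_nonneg L]

lemma polyBound_convolution {F' F : Type*} [NormedAddCommGroup F'] [NormedSpace ℝ F']
    [NormedAddCommGroup F] [NormedSpace ℝ F] (A : ℝ →L[ℝ] F' →L[ℝ] F) {φ : Base n → ℝ}
    (hφ : PolyBound φ) {g : Base n → F'} (hg : Continuous g) (hs : HasCompactSupport g) :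
    PolyBound (φ ⋆[A, volume] g) := by
  obtain ⟨r, hr0, hr⟩ := hs.isCompact.isBounded.exists_pos_norm_le
  obtain ⟨k, C, hC0, hC⟩ := hφ.nonneg_const
  refine ⟨k, ‖A‖ * (C * (1 + r) ^ k) * ∫ t, ‖g t‖, fun x => ?_⟩
  rw [convolution_eq_swap]
  have hi : Integrable fun t => ‖g t‖ := (hg.integrable_of_hasCompactSupport hs).norm
  have e : ‖A‖ * (C * (1 + r) ^ k) * (∫ t, ‖g t‖) * (1 + ‖x‖) ^ k
      = ∫ t, ‖A‖ * (C * (1 + r) ^ k) * (1 + ‖x‖) ^ k * ‖g t‖ := by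
    rw [integral_const_mul]; ring
  rw [e]
  refine norm_integral_le_of_norm_le (hi.const_mul _) (Filter.Eventually.of_forall fun t => ?_)
  by_cases ht : t ∈ tsupport g
  · refine (A.le_opNorm₂ _ _).trans ?_
    refine mul_le_mul_of_nonneg_right ?_ (norm_nonneg _)
    have h1 : 1 + ‖x - t‖ ≤ (1 + r) * (1 + ‖x‖) := by
      have := norm_sub_le x t
      have := hr t ht
      nlinarith [norm_nonneg x]
    calc ‖A‖ * ‖φ (x - t)‖ ≤ ‖A‖ * (C * ((1 + r) * (1 + ‖x‖)) ^ k) := by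
          gcongr
          exact (hC _).trans (by gcongr)
      _ = _ := by rw [mul_pow]; ring
  · simp [image_eq_zero_of_notMem_tsupport ht]

lemma polyBound_iteratedFDeriv_convolution {φ : Base n → ℝ} (hφ : PolyBound φ)
    (hc : Continuous φ) (k : ℕ) :
    ∀ {F' F : Type} [NormedAddCommGroup F'] [NormedSpace ℝ F'] [NormedAddCommGroup F]
      [NormedSpace ℝ F] (A : ℝ →L[ℝ] F' →L[ℝ] F) {g : Base n → F'} (_ : ContDiff ℝ ∞ g)
      (_ : HasCompactSupport g), PolyBound (iteratedFDeriv ℝ k (φ ⋆[A, volume] g)) := by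
  induction k with
  | zero =>
    intro F' F _ _ _ _ A g hg hs
    obtain ⟨m, C, h⟩ := polyBound_convolution A hφ hg.continuous hs
    exact ⟨m, C, fun x => by simpa using h x⟩
  | succ k ih =>
    intro F' F _ _ _ _ A g hg hs
    have e : fderiv ℝ (φ ⋆[A, volume] g) = φ ⋆[A.precompR (Base n), volume] fderiv ℝ g :=
      funext fun x => (hs.hasFDerivAt_convolution_right A hc.locallyIntegrable
        (hg.of_le (by simp)) x).fderiv
    obtain ⟨m, C, h⟩ := ih (A.precompR (Base n)) (hg.fderiv_right (m := ∞) (by simp))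
      (hs.fderiv ℝ)
    refine ⟨m, C, fun x => ?_⟩
    rw [← norm_iteratedFDeriv_fderiv, e]
    exact h x

/-- A Lipschitz function lies strictly below smooth functions of temperate growth that are
arbitrarily close to it and have the same Lipschitz constant. -/
lemma exists_smooth_above {L : ℝ≥0} {φ : Base n → ℝ} (hφ : LipschitzWith L φ) {δ : ℝ}
    (hδ : 0 < δ) :
    ∃ ψ : Base n → ℝ, HasTemperateGrowth ψ ∧ (∀ x, ‖fderiv ℝ ψ x‖ ≤ L) ∧
      ∀ x, φ x < ψ x ∧ ψ x ≤ φ x + (2 * L + 1) * δ := by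
  -- Mollification at scale `δ` moves `φ` by at most `L δ`; the shift by `(L + 1) δ` lifts the
  -- mollified function above `φ`.
  let ρ : ContDiffBump (0 : Base n) := ⟨δ / 2, δ, by positivity, by linarith⟩
  have hρc : Continuous (ρ.normed volume) := ρ.continuous_normed
  have hρs : HasCompactSupport (ρ.normed volume) := ρ.hasCompactSupport_normed
  have hρ1 : ∫ t, ρ.normed volume t = 1 := ρ.integral_normed
  set ψ₀ := φ ⋆[ContinuousLinearMap.lsmul ℝ ℝ, volume] ρ.normed volume with hψ₀
  have hc := hφ.continuous
  have hint : ∀ f : Base n → ℝ, Continuous f → Integrable fun t => f t * ρ.normed volume t :=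
    fun f hf => (hf.mul hρc).integrable_of_hasCompactSupport hρs.mul_left
  have heq : ∀ x, ψ₀ x = ∫ t, φ (x - t) * ρ.normed volume t := by
    intro x
    rw [hψ₀, convolution_eq_swap]
    rfl
  have hdiff : ∀ x y, |ψ₀ x - ψ₀ y| ≤ L * ‖x - y‖ := by
    intro x y
    rw [heq, heq, ← integral_sub (hint (fun t => φ (x - t)) (by fun_prop))
      (hint (fun t => φ (y - t)) (by fun_prop)), ← Real.norm_eq_abs]
    have e : L * ‖x - y‖ = ∫ t, L * ‖x - y‖ * ρ.normed volume t := by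
      rw [integral_const_mul, hρ1, mul_one]
    rw [e]
    refine norm_integral_le_of_norm_le (hint (fun _ => L * ‖x - y‖) continuous_const)
      (Filter.Eventually.of_forall fun t => ?_)
    rw [← sub_mul, norm_mul, Real.norm_of_nonneg (ρ.nonneg_normed t)]
    refine mul_le_mul_of_nonneg_right ?_ (ρ.nonneg_normed t)
    have := hφ.dist_le_mul (x - t) (y - t)
    rw [dist_eq_norm, dist_eq_norm] at this
    simpa using this
  have hclose : ∀ x, |ψ₀ x - φ x| ≤ L * δ := by
    intro x
    have e : φ x = ∫ t, φ x * ρ.normed volume t := by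
      rw [integral_const_mul, hρ1, mul_one]
    have e2 : L * δ = ∫ t, L * δ * ρ.normed volume t := by
      rw [integral_const_mul, hρ1, mul_one]
    rw [heq, e, ← integral_sub (hint (fun t => φ (x - t)) (by fun_prop))
      (hint (fun t => φ x) (by fun_prop)), ← Real.norm_eq_abs, e2]
    refine norm_integral_le_of_norm_le (hint (fun _ => L * δ) continuous_const)
      (Filter.Eventually.of_forall fun t => ?_)
    rw [← sub_mul, norm_mul, Real.norm_of_nonneg (ρ.nonneg_normed t)]
    by_cases ht : ρ.normed volume t = 0
    · simp [ht]
    · refine mul_le_mul_of_nonneg_right ?_ (ρ.nonneg_normed t)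
      have h1 : t ∈ Function.support (ρ.normed volume) := ht
      rw [ρ.support_normed_eq, mem_ball_zero_iff] at h1
      have := hφ.dist_le_mul (x - t) x
      rw [dist_eq_norm, dist_eq_norm] at this
      refine this.trans ?_
      gcongr
      simpa using h1.le
  have ht : HasTemperateGrowth ψ₀ :=
    ⟨hρs.contDiff_convolution_right _ hc.locallyIntegrable ρ.contDiff_normed,
      fun k => polyBound_iteratedFDeriv_convolution (LipschitzWith.polyBound hφ) hc k _
        ρ.contDiff_normed hρs⟩
  refine ⟨fun x => ψ₀ x + (L + 1) * δ, ht.add (HasTemperateGrowth.const _), fun x => ?_,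
    fun x => ?_⟩
  · rw [fderiv_add_const]
    refine norm_fderiv_le_of_lipschitz ℝ (LipschitzWith.of_dist_le_mul fun x y => ?_)
    rw [Real.dist_eq, dist_eq_norm]
    exact hdiff x y
  · have := abs_le.1 (hclose x)
    constructor <;> nlinarith

end

end LipschitzGraph

namespace LipschitzGraph

noncomputable section

open Set Metric Function
open scoped ContDiff

variable {n : ℕ}

/-! ### The Carleson estimate for the gradient -/

/-- Cutoff functions for a ball of radius `r` supported in the ball of radius `2 r`, with gradients
bounded by `κ / r`, obtained by scaling one function. -/
lemma exists_cutoff (n : ℕ) : ∃ κ : ℝ, 0 ≤ κ ∧ ∀ (z₀ : Base n) (r : ℝ), 0 < r →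
    ∃ η : Cutoff z₀ (2 * r) (κ / r), ∀ z ∈ closedBall z₀ r, η.b z = 1 := by
  let b₀ : ContDiffBump (0 : Base n) := ⟨1, 2, one_pos, one_lt_two⟩
  have hd : ContDiff ℝ 1 b₀ := b₀.contDiff
  have hc := hd.continuous_fderiv one_ne_zero
  obtain ⟨κ, hκ⟩ := (b₀.hasCompactSupport.fderiv ℝ).exists_bound_of_continuous hc
  refine ⟨κ, (norm_nonneg _).trans (hκ 0), fun z₀ r hr => ?_⟩
  refine ⟨{
    b := fun z => b₀ (r⁻¹ • (z - z₀))
    b' := fun z => r⁻¹ • grad b₀ (r⁻¹ • (z - z₀))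
    continuous_b := b₀.continuous.comp (by fun_prop)
    continuous_b' := by
      unfold grad
      have : Continuous fun z : Base n => fderiv ℝ b₀ (r⁻¹ • (z - z₀)) := hc.comp (by fun_prop)
      fun_prop
    grad_b := fun z => by
      rw [hasGradientAt_iff_hasFDerivAt]
      have h1 : HasFDerivAt (fun z : Base n => r⁻¹ • (z - z₀))
          (r⁻¹ • ContinuousLinearMap.id ℝ (Base n)) z :=
        ((hasFDerivAt_id z).sub_const z₀).const_smul r⁻¹
      refine ((hd.differentiable one_ne_zero _).hasFDerivAt.comp z h1).congr_fderiv ?_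
      ext y
      have := DFunLike.congr_fun (innerSL_vecOf (fderiv ℝ b₀ (r⁻¹ • (z - z₀)))) y
      simp only [innerSL_apply_apply] at this
      simp [grad, this]
    nonneg := fun z => b₀.nonneg
    le_one := fun z => b₀.le_one
    eq_zero := fun z hz => by
      apply b₀.zero_of_le_dist
      rw [mem_closedBall, not_le, dist_eq_norm] at hz
      rw [dist_zero_right, norm_smul, Real.norm_of_nonneg (inv_nonneg.2 hr.le),
        le_inv_mul_iff₀ hr]
      change r * 2 ≤ _
      linarith
    norm_b' := fun z => by
      rw [norm_smul, Real.norm_of_nonneg (inv_nonneg.2 hr.le), grad, norm_vecOf, div_eq_inv_mul]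
      exact mul_le_mul_of_nonneg_left (hκ _) (inv_nonneg.2 hr.le) }, fun z hz => ?_⟩
  apply b₀.one_of_mem_closedBall
  rw [mem_closedBall, dist_eq_norm] at hz
  rw [mem_closedBall, dist_zero_right, norm_smul, Real.norm_of_nonneg (inv_nonneg.2 hr.le),
    inv_mul_le_iff₀ hr]
  change _ ≤ r * 1
  linarith

section

variable {L B ℓ θ M T R κ : ℝ} {z₀ : Base n}

lemma height_sub_le (F : CaloricExtension n L B) (ℓ : ℝ) (z : Base n) {t : ℝ} (ht : 0 ≤ t) :
    F.P z t + ℓ * t - F.P z 0 ≤ (ℓ + B) * t := by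
  have hm : Monotone fun t => (ℓ + B) * t - (F.P z t + ℓ * t) := by
    refine monotone_of_hasDerivAt_nonneg
      (fun t => ((hasDerivAt_id t).const_mul (ℓ + B)).sub (hasDerivAt_height F ℓ z t)) fun t => ?_
    have := (abs_le.1 (F.abs_D z t)).2
    simp only [Pi.zero_apply]
    linarith
  have := hm ht
  simp only [mul_zero, zero_sub, add_zero] at this
  linarith

/-- Heights grow at least at unit speed in `t`. -/
lemma Ioo_subset_image_height (F : CaloricExtension n L B) (hℓ : 1 + B ≤ ℓ) (z : Base n) (a : ℝ) :
    Ioo (F.P z 0) (F.P z 0 + a) ⊆ (fun t => F.P z t + ℓ * t) '' Ioo 0 a := by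
  intro y hy
  have ha : 0 ≤ a := by linarith [hy.1, hy.2]
  have hm : Monotone fun t => F.P z t + ℓ * t - t := by
    refine monotone_of_hasDerivAt_nonneg
      (fun t => (hasDerivAt_height F ℓ z t).sub (hasDerivAt_id t)) fun t => ?_
    have := one_le_jacobian F hℓ z t
    simp only [Pi.zero_apply]
    linarith
  have h1 := hm ha
  simp only [mul_zero, add_zero, sub_zero] at h1
  have hc : ContinuousOn (fun t => F.P z t + ℓ * t) (Icc 0 a) := fun t _ =>
    (hasDerivAt_height F ℓ z t).continuousAt.continuousWithinAt
  have := intermediate_value_Ioo ha hc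
  simp only [mul_zero, add_zero] at this
  exact this ⟨hy.1, by linarith [hy.2]⟩

/-- The estimate for a smooth graph that lies strictly inside the domain, by the change of
variables `y = P(z, t) + ℓ t` on vertical lines. -/
lemma lintegral_caloric_le (F : CaloricExtension n L B) (hℓ : 1 + B ≤ ℓ) {φ : Base n → ℝ}
    (hφ : Continuous φ) (hP : ∀ z, φ z < F.P z 0) {u : Ambient n → ℝ}
    (hu : ContDiffOn ℝ 2 u (domain φ)) (hs : SharpCondition φ θ u)
    (hM : ∀ p ∈ domain φ, |u p| ≤ M) (hθ : θ < 1) (hT : 0 < T) (η : Cutoff z₀ R κ)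
    {s : Set (Base n)} (hsm : MeasurableSet s) (hsR : s ⊆ closedBall z₀ R)
    (hη : ∀ z ∈ s, η.b z = 1) :
    ∫⁻ z in s, ∫⁻ y in Ioo (F.P z 0) (F.P z 0 + T / 2),
        ENNReal.ofReal (y - F.P z 0) * gradSq u (WithLp.toLp 2 (z, y))
      ≤ ENNReal.ofReal (4 * (ℓ + B) *
        (energyConst L B ℓ θ (1 + κ * T) * M ^ 2 * volume.real (closedBall z₀ R))) := by
  have hB : 0 ≤ B := (abs_nonneg _).trans (F.abs_D z₀ 0)
  set w := flatSolution F hℓ hφ hP hu hs hM T with hw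
  set E : Base n × ℝ → ℝ := fun p => 4 * (ℓ + B) * (p.2 * η.sq T p.1 p.2 * (ℓ + p.2 * F.D p.1 p.2)
        * (‖w.U p.1 p.2‖ ^ 2 + w.Uy p.1 p.2 ^ 2)) with hE
  have hEc : Continuous E := by fun_prop
  have hE0 : ∀ z t, 0 ≤ t → 0 ≤ E (z, t) := by
    intro z t ht
    have h1 := one_le_jacobian F hℓ z t
    have h2 : 0 ≤ ℓ + t * F.D z t := by linarith
    have h3 : 0 ≤ ℓ + B := by linarith
    simp only [hE, Cutoff.sq]
    positivity
  have inner_le : ∀ z ∈ s, ∫⁻ y in Ioo (F.P z 0) (F.P z 0 + T / 2),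
        ENNReal.ofReal (y - F.P z 0) * gradSq u (WithLp.toLp 2 (z, y))
      ≤ ∫⁻ t in Icc 0 T, ENNReal.ofReal (E (z, t)) := by
    intro z hz
    refine (lintegral_mono_set (Ioo_subset_image_height F hℓ z (T / 2))).trans ?_
    rw [lintegral_image_eq_lintegral_deriv_mul_of_monotoneOn measurableSet_Ioo
      (fun t _ => (hasDerivAt_height F ℓ z t).hasDerivWithinAt)
      ((monotone_height F hℓ z).monotoneOn _)]
    refine (setLIntegral_mono' measurableSet_Ioo fun t ht => ?_).trans
      (lintegral_mono_set (Ioo_subset_Icc_self.trans (Icc_subset_Icc_right (by linarith))))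
    have h1 := one_le_jacobian F hℓ z t
    have h2 : 0 ≤ ℓ + t * F.D z t := by linarith
    have h3 := height_sub_le F ℓ z ht.1.le
    have h4 : 0 ≤ F.P z t + ℓ * t - F.P z 0 := by
      have := monotone_height F hℓ z ht.1.le
      simp only [mul_zero, add_zero] at this
      linarith
    have h5 : (WithLp.toLp 2 (z, F.P z t + ℓ * t) : Ambient n) = flatMap F ℓ z t := by
      rw [flatMap, incZ_add_vert, max_eq_left ht.1.le]
    have h6 : ‖gradient u (flatMap F ℓ z t)‖ ^ 2 = ‖w.U z t‖ ^ 2 + w.Uy z t ^ 2 :=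
      norm_gradient_sq u _
    rw [gradSq, h5, h6, ← ENNReal.ofReal_mul h4, ← ENNReal.ofReal_mul h2]
    apply ENNReal.ofReal_le_ofReal
    -- The time factor of the cutoff is at least `1 / 2` on the lower half of the slab.
    have h7 : 1 / 4 ≤ η.sq T z t := by
      have : t / T ≤ 1 / 2 := by
        rw [div_le_iff₀ hT]; linarith [ht.2]
      simp only [Cutoff.sq, hη z hz]
      nlinarith
    have hS : 0 ≤ ‖w.U z t‖ ^ 2 + w.Uy z t ^ 2 := by positivity
    have h8 : F.P z t + ℓ * t - F.P z 0 ≤ 4 * (ℓ + B) * (t * η.sq T z t) := by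
      have : (ℓ + B) * t * 1 ≤ (ℓ + B) * t * (4 * η.sq T z t) :=
        mul_le_mul_of_nonneg_left (by linarith) (mul_nonneg (by linarith) ht.1.le)
      linarith
    calc _ = (F.P z t + ℓ * t - F.P z 0)
          * ((ℓ + t * F.D z t) * (‖w.U z t‖ ^ 2 + w.Uy z t ^ 2)) := by ring
      _ ≤ 4 * (ℓ + B) * (t * η.sq T z t)
          * ((ℓ + t * F.D z t) * (‖w.U z t‖ ^ 2 + w.Uy z t ^ 2)) := by gcongr
      _ = _ := by simp only [hE]; ring
  calc _ ≤ ∫⁻ z in s, ∫⁻ t in Icc 0 T, ENNReal.ofReal (E (z, t)) :=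
        setLIntegral_mono' hsm inner_le
    _ ≤ ∫⁻ z in closedBall z₀ R, ∫⁻ t in Icc 0 T, ENNReal.ofReal (E (z, t)) :=
        lintegral_mono_set hsR
    _ = ∫⁻ p, ENNReal.ofReal (E p) ∂slab z₀ R T := by
        rw [slab, lintegral_prod _ (by fun_prop)]
    _ = ENNReal.ofReal (∫ p, E p ∂slab z₀ R T) := by
        rw [ofReal_integral_eq_lintegral_ofReal (integrable_slab hEc _ _ _)]
        filter_upwards [ae_slab z₀ R T] with p hp using hE0 p.1 p.2 hp.2.1
    _ ≤ _ := by
        apply ENNReal.ofReal_le_ofReal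
        rw [integral_const_mul]
        exact mul_le_mul_of_nonneg_left (w.integral_energy_le η hℓ hθ hT) (by linarith)

end

lemma measurable_gradSq (u : Ambient n → ℝ) : Measurable (gradSq u) := by
  unfold gradSq gradient
  have := measurable_fderiv ℝ u
  have h2 : Measurable fun p => ‖(InnerProductSpace.toDual ℝ (Ambient n)).symm (fderiv ℝ u p)‖ := by
    simp_rw [LinearIsometryEquiv.norm_map]
    exact this.norm
  exact (h2.pow_const 2).ennreal_ofReal

end

end LipschitzGraph

namespace LipschitzGraph

noncomputable section

open Set Metric Function
open scoped ContDiff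

variable {n : ℕ}

/-! ### Passage to Lipschitz graphs -/

lemma volume_closedBall_eq (z : Base n) {r : ℝ} (hr : 0 ≤ r) :
    volume (closedBall z r) = ENNReal.ofReal (r ^ n * volume.real (ball (0 : Base n) 1)) := by
  rw [Measure.addHaar_closedBall _ _ hr, ENNReal.ofReal_mul (by positivity),
    ofReal_measureReal measure_ball_lt_top.ne, finrank_euclideanSpace_fin]

/-- The Carleson estimate `∫ |∇u|² (y - φ(z)) dz dy ≤ C M² lⁿ` over the part of the strip
`φ(z) < y < φ(z) + l` above a ball of radius `K l`. Fatou's lemma carries the estimate from smooth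
graphs decreasing to `φ` over to `φ`; the constant depends only on the Lipschitz constant. -/
theorem exists_carleson_const (n : ℕ) (L : ℝ≥0) {θ K : ℝ} (hθ : θ < 1) (hK : 0 < K) :
    ∃ C : ℝ, 0 ≤ C ∧ ∀ φ : Base n → ℝ, LipschitzWith L φ →
      ∀ u : Ambient n → ℝ, ContDiffOn ℝ 2 u (domain φ) → SharpCondition φ θ u →
      ∀ M : ℝ, (∀ p ∈ domain φ, |u p| ≤ M) → ∀ (z₀ : Base n) (l : ℝ), 0 < l →
        ∫⁻ z in closedBall z₀ (K * l), ∫⁻ y in Ioo (φ z) (φ z + l),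
            ENNReal.ofReal (y - φ z) * gradSq u (WithLp.toLp 2 (z, y))
          ≤ ENNReal.ofReal (C * M ^ 2 * l ^ n) := by
  obtain ⟨κ, hκ, hcut⟩ := exists_cutoff n
  set B : ℝ := L * gaussMoment n with hB
  set v₀ := volume.real (ball (0 : Base n) 1)
  set C₀ := 4 * (1 + B + B) * energyConst L B (1 + B) θ (1 + κ * 2 / K) *
    ((2 * K) ^ n * v₀) with hC₀
  refine ⟨|C₀|, abs_nonneg _, fun φ hφ u hu hs M hM z₀ l hl => ?_⟩
  have hr : 0 < K * l := by positivity
  obtain ⟨η, hη⟩ := hcut z₀ (K * l) hr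
  have hδ : ∀ k : ℕ, 0 < 1 / ((k : ℝ) + 1) := fun k => Nat.one_div_pos_of_nat
  choose ψ hψt hψL hψ using fun k : ℕ => exists_smooth_above hφ (hδ k)
  have hψc : ∀ k, Continuous (ψ k) := fun k => (hψt k).1.continuous
  have hψlim : ∀ z, Filter.Tendsto (fun k => ψ k z) Filter.atTop (nhds (φ z)) := by
    intro z
    refine tendsto_of_tendsto_of_tendsto_of_le_of_le tendsto_const_nhds ?_
      (fun k => (hψ k z).1.le) (fun k => (hψ k z).2)
    simpa using ((tendsto_one_div_add_atTop_nhds_zero_nat (𝕜 := ℝ)).const_mul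
      (2 * (L : ℝ) + 1)).const_add (φ z)
  -- The truncated integrand over a graph `ρ`, as a function on the product space.
  let A : (Base n → ℝ) → Set (Base n × ℝ) := fun ρ => {p | ρ p.1 < p.2 ∧ p.2 < ρ p.1 + l}
  let f : (Base n → ℝ) → Base n × ℝ → ℝ≥0∞ := fun ρ => (A ρ).indicator
    fun p => ENNReal.ofReal (p.2 - ρ p.1) * gradSq u (WithLp.toLp 2 p)
  have hfm : ∀ ρ, Continuous ρ → Measurable (f ρ) := by
    intro ρ hρ
    refine Measurable.indicator ?_ ?_
    · refine Measurable.mul (by fun_prop) ((measurable_gradSq u).comp ?_)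
      exact (WithLp.prod_continuous_toLp 2 _ _).measurable
    · have h1 : Measurable fun p : Base n × ℝ => ρ p.1 := by fun_prop
      exact (measurableSet_lt h1 measurable_snd).inter
        (measurableSet_lt measurable_snd (h1.add_const l))
  have hfi : ∀ ρ, Continuous ρ →
      ∫⁻ p, f ρ p ∂((volume.restrict (closedBall z₀ (K * l))).prod volume)
      = ∫⁻ z in closedBall z₀ (K * l), ∫⁻ y in Ioo (ρ z) (ρ z + l),
            ENNReal.ofReal (y - ρ z) * gradSq u (WithLp.toLp 2 (z, y)) := by
    intro ρ hρ
    rw [lintegral_prod _ (hfm ρ hρ).aemeasurable]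
    congr! 2 with z
    rw [← lintegral_indicator measurableSet_Ioo]
    rfl
  have hbound : ∀ k, ∫⁻ p, f (ψ k) p ∂((volume.restrict (closedBall z₀ (K * l))).prod volume)
      ≤ ENNReal.ofReal (|C₀| * M ^ 2 * l ^ n) := by
    intro k
    let F := caloricExtension (ψ k) (hψt k) (hψL k)
    have hF : ∀ z, F.P z 0 = ψ k z := fun z => heat_zero _ _
    have h := lintegral_caloric_le F (ℓ := 1 + B) le_rfl hφ.continuous
      (fun z => by rw [hF]; exact (hψ k z).1) hu hs hM hθ (T := 2 * l) (by positivity) η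
      measurableSet_closedBall (closedBall_subset_closedBall (by linarith)) hη
    simp only [hF, mul_div_cancel_left₀ l (two_ne_zero (α := ℝ))] at h
    rw [hfi _ (hψc k)]
    refine h.trans (ENNReal.ofReal_le_ofReal ?_)
    rw [measureReal_def, volume_closedBall_eq _ (by positivity),
      ENNReal.toReal_ofReal (by positivity)]
    calc _ = C₀ * M ^ 2 * l ^ n := by
          rw [hC₀, show κ / (K * l) * (2 * l) = κ * 2 / K by field_simp]
          ring
      _ ≤ _ := by gcongr; exact le_abs_self _
  rw [← hfi φ hφ.continuous]
  calc _ ≤ ∫⁻ p, Filter.liminf (fun k => f (ψ k) p) Filter.atTop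
          ∂((volume.restrict (closedBall z₀ (K * l))).prod volume) := by
        refine lintegral_mono fun p => ?_
        by_cases hp : φ p.1 < p.2 ∧ p.2 < φ p.1 + l
        · have h1 : ∀ᶠ k in Filter.atTop, f (ψ k) p
              = ENNReal.ofReal (p.2 - ψ k p.1) * gradSq u (WithLp.toLp 2 p) := by
            filter_upwards [(hψlim p.1).eventually_lt_const hp.1] with k hk
            exact indicator_of_mem (s := A (ψ k)) ⟨hk, hp.2.trans (by linarith [(hψ k p.1).1])⟩ _
          have h2 : Filter.Tendsto (fun k => f (ψ k) p) Filter.atTop (nhds (f φ p)) := by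
            rw [show f φ p = ENNReal.ofReal (p.2 - φ p.1) * gradSq u (WithLp.toLp 2 p) from
              indicator_of_mem (s := A φ) hp _]
            refine Filter.Tendsto.congr' (Filter.EventuallyEq.symm h1) ?_
            exact ENNReal.Tendsto.mul_const (ENNReal.tendsto_ofReal ((hψlim p.1).const_sub _))
              (Or.inr ENNReal.ofReal_ne_top)
          rw [h2.liminf_eq]
        · rw [show f φ p = 0 from indicator_of_notMem (s := A φ) hp _]
          exact zero_le
    _ ≤ Filter.liminf (fun k => ∫⁻ p, f (ψ k) p
          ∂((volume.restrict (closedBall z₀ (K * l))).prod volume)) Filter.atTop :=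
        lintegral_liminf_le fun k => hfm _ (hψc k)
    _ ≤ Filter.liminf (fun _ : ℕ => ENNReal.ofReal (|C₀| * M ^ 2 * l ^ n)) Filter.atTop :=
        Filter.liminf_le_liminf (Filter.Eventually.of_forall hbound)
    _ = _ := Filter.liminf_const _

end

end LipschitzGraph

namespace LipschitzGraph

noncomputable section

open Set Metric Function
open scoped ContDiff

variable {n : ℕ}

/-! ### The area function -/

lemma sideLength_pos (m : ℤ) : 0 < sideLength m := by
  unfold sideLength; positivity

lemma dyadicCube_subset_closedBall (m : ℤ) (j : Fin n → ℤ) :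
    ∃ z₀ : Base n, dyadicCube m j ⊆ closedBall z₀ (√n * sideLength m) := by
  have hl := sideLength_pos m
  refine ⟨WithLp.toLp 2 fun i => (j i : ℝ) * sideLength m, fun x hx => ?_⟩
  have h0 : √n * sideLength m = √(n * sideLength m ^ 2) := by
    rw [Real.sqrt_mul (Nat.cast_nonneg n), Real.sqrt_sq hl.le]
  rw [mem_closedBall, dist_eq_norm, EuclideanSpace.norm_eq, h0]
  apply Real.sqrt_le_sqrt
  calc _ ≤ ∑ _i : Fin n, sideLength m ^ 2 := by
        refine Finset.sum_le_sum fun i _ => ?_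
        obtain ⟨h1, h2⟩ := hx i
        rw [Real.norm_eq_abs, sq_abs]
        apply pow_le_pow_left₀ <;> simp only [PiLp.sub_apply] <;> linarith
    _ = _ := by simp

lemma measurableSet_dyadicCube (m : ℤ) (j : Fin n → ℤ) :
    MeasurableSet (dyadicCube m j) := by
  have h : ∀ i, Measurable fun x : Base n => x i := fun i => by fun_prop
  simp only [dyadicCube, ofPred_forall]
  exact MeasurableSet.iInter fun i => (measurableSet_le measurable_const (h i)).inter
    (measurableSet_le (h i) measurable_const)

lemma areaFunction_sq (φ : Base n → ℝ) (α s t : ℝ) (f : Ambient n → ℝ≥0∞) (x : Base n) :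
    areaFunction φ α s t f x ^ 2 = ∫⁻ p in truncatedCone φ α s t x,
      f p * ENNReal.ofReal ((p.snd - φ x) ^ (1 - (n : ℤ))) := by
  rw [areaFunction, ← ENNReal.rpow_natCast, ← ENNReal.rpow_mul]
  norm_num

section

variable {L : ℝ≥0} {α l : ℝ} {φ : Base n → ℝ} {x : Base n} {p : Ambient n}

/-- On a cone of aperture `α < 1 / L` the height above the graph is comparable to the height
above the vertex. -/
lemma height_comparable (hφ : LipschitzWith L φ)
    (hp : p ∈ cone φ α x) :
    (1 - α * L) * (p.snd - φ x) ≤ p.snd - φ p.fst ∧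
      p.snd - φ p.fst ≤ (1 + α * L) * (p.snd - φ x) := by
  have h1 := hφ.dist_le_mul p.fst x
  rw [Real.dist_eq, dist_eq_norm] at h1
  have h2 : ‖p.fst - x‖ < α * (p.snd - φ x) := hp
  have h3 : (L : ℝ) * ‖p.fst - x‖ ≤ L * (α * (p.snd - φ x)) := by gcongr
  have h4 := abs_le.1 h1
  constructor <;> linarith

/-- The vertex of a cone through `(z, y)` lies in a ball about `z`. -/
lemma norm_sub_lt_of_mem_cone (hφ : LipschitzWith L φ) (hα : 0 < α) (hαL : α * L < 1)
    (hp : p ∈ cone φ α x) :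
    ‖p.fst - x‖ < α / (1 - α * L) * (p.snd - φ p.fst) := by
  have h0 : 0 < 1 - α * L := by linarith
  refine lt_of_lt_of_le hp ?_
  rw [div_mul_eq_mul_div, mul_div_assoc]
  gcongr
  rw [le_div_iff₀ h0, mul_comm]
  exact (height_comparable hφ hp).1

lemma zpow_one_sub_le (hn : 1 ≤ n) (hφ : LipschitzWith L φ) (hα : 0 < α)
    (hp : p ∈ cone φ α x) (hd : 0 < p.snd - φ p.fst) :
    (p.snd - φ x) ^ (1 - (n : ℤ))
      ≤ (1 + α * L) ^ (n - 1) * (p.snd - φ p.fst) ^ (1 - (n : ℤ)) := by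
  have h0 : 0 < 1 + α * (L : ℝ) := by positivity
  have e : ∀ a : ℝ, a ^ (1 - (n : ℤ)) = (a ^ (n - 1))⁻¹ := fun a => by
    rw [← zpow_natCast, ← zpow_neg]
    congr 1
    omega
  have h1 := (height_comparable hφ hp).2
  have h2 : 0 < p.snd - φ x := by
    by_contra h
    nlinarith
  rw [e, e, ← div_eq_mul_inv, inv_le_comm₀ (by positivity) (by positivity), inv_div,
    div_le_iff₀ (by positivity), ← mul_pow, mul_comm]
  exact pow_le_pow_left₀ hd.le h1 _

/-- Integrating the square of the area function and exchanging the order of integration leaves the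
weight `y - φ(z)`: the points `x` whose cone contains `(z, y)` lie in a ball about `z` of
radius comparable to `y - φ(z)`. -/
lemma lintegral_areaFunction_sq_le (hn : 1 ≤ n) (hφ : LipschitzWith L φ) (hα : 0 < α)
    (hαL : α * L < 1) {f : Ambient n → ℝ≥0∞} (hf : Measurable f) {Q : Set (Base n)}
    (hQ : MeasurableSet Q) {z₀ : Base n} {r : ℝ} (hQr : Q ⊆ closedBall z₀ r) :
    ∫⁻ x in Q, areaFunction φ α 0 l f x ^ 2
      ≤ ENNReal.ofReal ((1 + α * L) ^ (n - 1) *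
          ((α / (1 - α * L)) ^ n * volume.real (ball (0 : Base n) 1))) *
        ∫⁻ z in closedBall z₀ (r + α / (1 - α * L) * l), ∫⁻ y in Ioo (φ z) (φ z + l),
          ENNReal.ofReal (y - φ z) * f (WithLp.toLp 2 (z, y)) := by
  have h0 : 0 < 1 - α * L := by linarith
  set a := α / (1 - α * L) with ha
  have ha0 : 0 < a := div_pos hα h0
  set b := (1 + α * (L : ℝ)) ^ (n - 1) with hb
  have hb0 : 0 ≤ b := by positivity
  set v₀ := volume.real (ball (0 : Base n) 1) with hv₀
  have hφc := hφ.continuous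
  have hφm : Measurable φ := hφc.measurable
  have hfst : Measurable fun p : Ambient n => p.fst := by
    exact (WithLp.prod_continuous_ofLp 2 _ _).fst.measurable
  have hsnd : Measurable fun p : Ambient n => p.snd := by
    exact (WithLp.prod_continuous_ofLp 2 _ _).snd.measurable
  let V : Set (Ambient n) := {p | p.fst ∈ closedBall z₀ (r + a * l) ∧
    φ p.fst < p.snd ∧ p.snd < φ p.fst + l}
  have hV : MeasurableSet V :=
    (hfst measurableSet_closedBall).inter
      ((measurableSet_lt (hφm.comp hfst) hsnd).inter
        (measurableSet_lt hsnd ((hφm.comp hfst).add_const l)))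
  let g : Ambient n → ℝ≥0∞ := fun p =>
    f p * ENNReal.ofReal (b * (p.snd - φ p.fst) ^ (1 - (n : ℤ)))
  have hg : Measurable g := by
    have : Measurable fun p : Ambient n => (p.snd - φ p.fst) ^ (1 - (n : ℤ)) :=
      (hsnd.sub (hφm.comp hfst)).pow_const _
    exact hf.mul (this.const_mul b).ennreal_ofReal
  -- A majorant of the integrand whose dependence on `x` is the indicator function of a ball.
  let h : Base n → Ambient n → ℝ≥0∞ := fun x p =>
    (ball p.fst (a * (p.snd - φ p.fst))).indicator (fun _ => g p) x
  have hh : Measurable (uncurry h) := by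
    have : uncurry h = {q : Base n × Ambient n |
        dist q.1 q.2.fst < a * (q.2.snd - φ q.2.fst)}.indicator fun q => g q.2 := rfl
    rw [this]
    have h1 : Measurable fun q : Base n × Ambient n => q.2.fst := hfst.comp measurable_snd
    have h2 : Measurable fun q : Base n × Ambient n => q.2.snd := hsnd.comp measurable_snd
    exact (hg.comp measurable_snd).indicator (measurableSet_lt (measurable_fst.dist h1)
      ((h2.sub (hφm.comp h1)).const_mul a))
  have hcone : ∀ x, MeasurableSet (truncatedCone φ α 0 l x) := fun x =>
    (measurableSet_lt (hfst.sub_const x).norm ((hsnd.sub_const _).const_mul α)).inter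
      ((measurableSet_lt ((hφm.comp hfst).add_const 0) hsnd).inter
        (measurableSet_lt hsnd ((hφm.comp hfst).add_const l)))
  have hsub : ∀ x ∈ Q, areaFunction φ α 0 l f x ^ 2 ≤ ∫⁻ p in V, h x p := by
    intro x hx
    rw [areaFunction_sq]
    calc _ ≤ ∫⁻ p in truncatedCone φ α 0 l x, h x p := by
          refine setLIntegral_mono' (hcone x) fun p hp => ?_
          have h1 := norm_sub_lt_of_mem_cone hφ hα hαL hp.1
          have h2 : h x p = g p := by
            refine indicator_of_mem ?_ _
            rwa [mem_ball, dist_comm, dist_eq_norm]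
          rw [h2]
          simp only [g]
          gcongr
          refine zpow_one_sub_le hn hφ hα hp.1 ?_
          have := hp.2.1
          linarith
      _ ≤ _ := by
          refine lintegral_mono_set fun p hp => ?_
          have h1 := norm_sub_lt_of_mem_cone hφ hα hαL hp.1
          obtain ⟨h2, h3⟩ := hp.2
          refine ⟨?_, by linarith, h3⟩
          have h4 := hQr hx
          rw [mem_closedBall] at h4 ⊢
          have h5 := dist_triangle p.fst x z₀
          rw [dist_eq_norm p.fst x] at h5
          have h6 : a * (p.snd - φ p.fst) ≤ a * l := by gcongr; linarith
          linarith
  have hinner : ∀ p ∈ V, ∫⁻ x in Q, h x p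
      ≤ ENNReal.ofReal (b * (a ^ n * v₀)) * (ENNReal.ofReal (p.snd - φ p.fst) * f p) := by
    intro p hp
    have hd : 0 < p.snd - φ p.fst := sub_pos.2 hp.2.1
    calc _ ≤ ∫⁻ x, h x p := setLIntegral_le_lintegral _ _
      _ = g p * volume (ball p.fst (a * (p.snd - φ p.fst))) := by
          rw [lintegral_indicator_const measurableSet_ball]
      _ = _ := by
          rw [Measure.addHaar_ball_of_pos _ _ (by positivity), finrank_euclideanSpace_fin,
            ← ofReal_measureReal measure_ball_lt_top.ne, ← hv₀]
          simp only [g]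
          rw [mul_assoc, ← ENNReal.ofReal_mul (by positivity), ← ENNReal.ofReal_mul (by positivity),
            ← mul_assoc (ENNReal.ofReal _), ← ENNReal.ofReal_mul (by positivity), mul_comm (f p)]
          congr 2
          have e : (p.snd - φ p.fst) ^ (1 - (n : ℤ)) * (p.snd - φ p.fst) ^ n
              = p.snd - φ p.fst := by
            rw [← zpow_natCast, ← zpow_add₀ hd.ne']
            simp
          rw [mul_pow]
          linear_combination b * a ^ n * v₀ * e
  calc _ ≤ ∫⁻ x in Q, ∫⁻ p in V, h x p := setLIntegral_mono' hQ hsub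
    _ = ∫⁻ p in V, ∫⁻ x in Q, h x p := lintegral_lintegral_swap hh.aemeasurable
    _ ≤ ∫⁻ p in V, ENNReal.ofReal (b * (a ^ n * v₀)) *
          (ENNReal.ofReal (p.snd - φ p.fst) * f p) := setLIntegral_mono' hV hinner
    _ = ENNReal.ofReal (b * (a ^ n * v₀)) *
          ∫⁻ p in V, ENNReal.ofReal (p.snd - φ p.fst) * f p :=
        lintegral_const_mul _ ((hsnd.sub (hφm.comp hfst)).ennreal_ofReal.mul hf)
    _ = _ := by
        congr 1
        have hm : Measurable (fun p : Ambient n => ENNReal.ofReal (p.snd - φ p.fst) * f p) :=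
          (hsnd.sub (hφm.comp hfst)).ennreal_ofReal.mul hf
        have htm : Measurable (fun p : Base n × ℝ => (WithLp.toLp 2 p : Ambient n)) :=
          (WithLp.prod_continuous_toLp 2 _ _).measurable
        rw [← lintegral_indicator hV, ← (WithLp.volume_preserving_toLp (Base n) ℝ).lintegral_comp
          (hm.indicator hV), Measure.volume_eq_prod,
          lintegral_prod (fun q => V.indicator _ (WithLp.toLp 2 q))
            ((hm.indicator hV).comp htm).aemeasurable,
          ← lintegral_indicator measurableSet_closedBall]
        refine lintegral_congr fun z => ?_
        by_cases hz : z ∈ closedBall z₀ (r + a * l)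
        · rw [indicator_of_mem hz, ← lintegral_indicator measurableSet_Ioo]
          refine lintegral_congr fun y => ?_
          by_cases hy : y ∈ Ioo (φ z) (φ z + l)
          · rw [indicator_of_mem hy,
              indicator_of_mem (show WithLp.toLp 2 (z, y) ∈ V from ⟨hz, hy⟩)]
            rfl
          · rw [indicator_of_notMem hy, indicator_of_notMem fun h => hy h.2]
        · rw [indicator_of_notMem hz]
          simp_rw [indicator_of_notMem (show WithLp.toLp 2 (z, _) ∉ V from fun h => hz h.1)]
          simp

end

end

end LipschitzGraph

open LipschitzGraph in
theorem proposition2p4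
    (n : ℕ) (hn : 1 ≤ n) (L : ℝ≥0) (α θ : ℝ) (hα : 0 < α) (hαL : α * (L : ℝ) < 1)
    (hθ₀ : 0 < θ) (hθ₁ : θ < 1) :
    ∃ c : ℝ, 0 < c ∧
      ∀ φ : Base n → ℝ, LipschitzWith L φ →
      ∀ u : Ambient n → ℝ, ContDiffOn ℝ 2 u (domain φ) → SharpCondition φ θ u →
      ∀ M : ℝ, 0 < M → (∀ p ∈ domain φ, |u p| ≤ M) →
      ∀ (m : ℤ) (j : Fin n → ℤ),
        ∫⁻ x in dyadicCube m j, (areaFunction φ α 0 (sideLength m) (gradSq u) x) ^ 2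
          < ENNReal.ofReal (c * M ^ 2 * sideLength m ^ n) := by
  have h0 : 0 < 1 - α * (L : ℝ) := by linarith
  have hK : 0 < √n + α / (1 - α * L) := by positivity
  obtain ⟨C, hC0, hC⟩ := exists_carleson_const n L hθ₁ hK
  set b := (1 + α * (L : ℝ)) ^ (n - 1) *
    ((α / (1 - α * L)) ^ n * volume.real (Metric.ball (0 : Base n) 1)) with hb
  have hb0 : 0 ≤ b := by positivity
  -- The summand `1` makes the inequality strict.
  refine ⟨b * C + 1, by positivity, fun φ hφ u hu hs M hM huM m j => ?_⟩
  have hl := sideLength_pos m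
  obtain ⟨z₀, hz₀⟩ := dyadicCube_subset_closedBall m j
  have h := hC φ hφ u hu hs M huM z₀ _ hl
  rw [add_mul] at h
  calc _ ≤ _ := lintegral_areaFunction_sq_le hn hφ hα hαL (measurable_gradSq u)
        (measurableSet_dyadicCube m j) hz₀
    _ ≤ ENNReal.ofReal b * ENNReal.ofReal (C * M ^ 2 * sideLength m ^ n) := by gcongr
    _ = ENNReal.ofReal (b * (C * M ^ 2 * sideLength m ^ n)) := (ENNReal.ofReal_mul hb0).symm
    _ < _ := by
      rw [ENNReal.ofReal_lt_ofReal_iff (by positivity)]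
      have : 0 < M ^ 2 * sideLength m ^ n := by positivity
      linarith
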